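/- Let $q\in\mathbb C$ with $0<|q|<1$, and write $(z)_\infty=\prod_{i\ge 0}(1-zq^i)$, $(z)_k=\prod_{i=0}^{k-1}(1-zq^i)$ for $k\in\mathbb Z_{\ge0}$, and $(z_1,\dots,z_p)_k=(z_1)_k\cdots(z_p)_k$ (also for $k=\infty$). For $\boldsymbol k=(k_1,\dots,k_n)\in\mathbb Z_{\ge 0}^n$ put $|\boldsymbol k|=k_1+\cdots+k_n$. Let $\alpha,b,c,d,\beta,\gamma,x_1,\dots,x_n,a_1,\dots,a_n$ be complex numbers and put $A=a_1\cdots a_n q^{-n}$. Suppose that either $$|A|<1,\qquad |\alpha\beta A|<1,\qquad |\alpha\gamma A|<1,$$ or $a_r=q^{N_r}$ with positive integers $N_r$ for $r=1,\dots,n$ (so that the series terminates). Suppose that none of the denominators in the following identity vanishes (in particular all $x_r$ and $a_r$ are nonzero). Then $$\begin{aligned} &\frac{(\alpha\beta,\alpha\gamma,\alpha A c,\alpha A d)_\infty}{(\alpha c,\alpha d,\alpha\beta A,\alpha\gamma A)_\infty}\prod_{r=1}^n\frac{(\alpha q x_r,\alpha a_r b x_r/q)_\infty}{(\alpha b x_r,\alpha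 a_r x_r)_\infty}\\ &=\sum_{k_1,\dots,k_n\ge 0}\ \prod_{1\le r<s\le n}\frac{1-q^{k_r-k_s}x_r/x_s}{1-x_r/x_s}\prod_{r,s=1}^n\frac{(q x_r/(x_s a_s))_{k_r}}{(q x_r/x_s)_{k_r}}\\ &\quad\times\prod_{r=1}^n\frac{1-\alpha x_r q^{k_r+|\boldsymbol k|}}{1-\alpha x_r}\prod_{r=1}^n\frac{(\alpha x_r)_{|\boldsymbol k|}}{(\alpha x_r a_r)_{|\boldsymbol k|}}\,(a_1\cdots a_n)^{|\boldsymbol k|}q^{\sum_{r=1}^n(r-1)k_r-n|\boldsymbol k|}\\ &\quad\times\sum_{\substack{0\le m_r\le k_r\\ r=1,\dots,n}}\ \prod_{1\le r<s\le n}\frac{1-q^{m_r-m_s}x_r/x_s}{1-x_r/x_s}\prod_{r,s=1}^n\frac{(q^{-k_s}x_r/x_s)_{m_r}}{(q x_r/x_s)_{m_r}}\\ &\qquad\times\prod_{r=1}^n\frac{(\alpha x_r q^{|\boldsymbol k|})_{m_r}}{(\alpha b x_r)_{m_r}}\cdot\frac{(\alpha\beta,\alpha\gamma)_{|\boldsymbol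 m|}}{(\alpha c,\alpha d)_{|\boldsymbol m|}}\,q^{\sum_{r=1}^n r m_r}, \end{aligned}$$ where the outer multiple series converges absolutely. -/

import Mathlib

open scoped BigOperators

noncomputable section

/-- The infinite `q`-shifted factorial `(z; q)_∞ = ∏_{i ≥ 0} (1 - z q^i)`. -/
def qPochInf (q z : ℂ) : ℂ := ∏' i : ℕ, (1 - z * q ^ i)

/-- The finite `q`-shifted factorial `(z; q)_k = ∏_{0 ≤ i < k} (1 - z q^i)`. -/
def qPoch (q z : ℂ) (k : ℕ) : ℂ := ∏ i ∈ Finset.range k, (1 - z * q ^ i)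

/-- `|k| = k_1 + ⋯ + k_n`. -/
def multiDeg {n : ℕ} (k : Fin n → ℕ) : ℕ := ∑ r, k r

/-- The `A_n` factor `∏_{1 ≤ r < s ≤ n} (1 - q^{k_r - k_s} x_r / x_s) / (1 - x_r / x_s)`. -/
def anFactor {n : ℕ} (q : ℂ) (x : Fin n → ℂ) (k : Fin n → ℕ) : ℂ :=
  ∏ r, ∏ s ∈ Finset.Ioi r,
    (1 - q ^ ((k r : ℤ) - (k s : ℤ)) * x r / x s) / (1 - x r / x s)

/-- The inner sum over `0 ≤ m_r ≤ k_r`. The index `r : Fin n` starts from `0`, so the exponent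
`∑ r m_r` (with `r` from `1` to `n`) is `∑ (r + 1) m_r` here. -/
def anInnerSum {n : ℕ} (q α b c d β γ : ℂ) (x : Fin n → ℂ) (k : Fin n → ℕ) : ℂ :=
  ∑ m ∈ Finset.Iic k,
    anFactor q x m
      * (∏ r, ∏ s, qPoch q (q ^ (-(k s : ℤ)) * x r / x s) (m r) / qPoch q (q * x r / x s) (m r))
      * (∏ r, qPoch q (α * x r * q ^ multiDeg k) (m r) / qPoch q (α * b * x r) (m r))
      * (qPoch q (α * β) (multiDeg m) * qPoch q (α * γ) (multiDeg m)
          / (qPoch q (α * c) (multiDeg m) * qPoch q (α * d) (multiDeg m)))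
      * q ^ (∑ r : Fin n, ((r : ℕ) + 1) * m r)

/-- The summand of the outer series; it contains the inner sum as its last factor. The index
`r : Fin n` starts from `0`, so `∑ (r - 1) k_r` (with `r` from `1` to `n`) is `∑ r k_r` here. -/
def anOuterTerm {n : ℕ} (q α b c d β γ : ℂ) (x a : Fin n → ℂ) (k : Fin n → ℕ) : ℂ :=
  anFactor q x k
    * (∏ r, ∏ s, qPoch q (q * x r / (x s * a s)) (k r) / qPoch q (q * x r / x s) (k r))
    * (∏ r, (1 - α * x r * q ^ (k r + multiDeg k)) / (1 - α * x r))
    * (∏ r, qPoch q (α * x r) (multiDeg k) / qPoch q (α * x r * a r) (multiDeg k))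
    * (∏ r, a r) ^ multiDeg k
    * q ^ (((∑ r : Fin n, (r : ℕ) * k r : ℕ) : ℤ) - (n : ℤ) * (multiDeg k : ℤ))
    * anInnerSum q α b c d β γ x k

/-- The infinite product side; here `A = a_1 ⋯ a_n / q^n`. -/
def anProductSide {n : ℕ} (q α b c d β γ : ℂ) (x a : Fin n → ℂ) : ℂ :=
  let A : ℂ := (∏ r, a r) / q ^ n
  qPochInf q (α * β) * qPochInf q (α * γ) * qPochInf q (α * A * c) * qPochInf q (α * A * d)
      / (qPochInf q (α * c) * qPochInf q (α * d)
          * qPochInf q (α * β * A) * qPochInf q (α * γ * A))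
    * ∏ r, qPochInf q (α * q * x r) * qPochInf q (α * a r * b * x r / q)
        / (qPochInf q (α * b * x r) * qPochInf q (α * a r * x r))

end

/-! The identity is proved first on the discrete set `a_r = q^(M_r + 1)`, where it is a finite
matrix inversion, and then continued analytically in the `a_r`.

Terminating case. All summations rest on one rational identity, `sum_lagCoeff_mul_prod`, obtained by
Lagrange interpolation. Since the weight `anWeight` satisfies a first-order relation in each index
(`anWeight_transfer`), the interpolation identity relates sums over `|m| = L` to sums over `|m| = L
+ 1`. This gives an `A_n` `q`-binomial sum (`sum_anWeight`) and a very-well-poised variant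
(`sum_anWeight_mul_prod`) that makes partial sums telescope. When `w = x q^M`, the telescoped total
contains a factor that vanishes unless `M = 0`; this is an orthogonality relation
(`sum_Iic_orthogonality`). After interchanging the two sums of the theorem, it leaves only the term
`m = M` (`terminating_expansion`), which is the product side.

Bounding the inner sum. Its terms contain `q^(-k_s)` and can be enormous, so cancellation must be
used. A second application of the interpolation identity shows that raising `k_s` by one amounts to
replacing the coefficient sequence `F` by a combination of its `q`-difference, itself and its shift
(`dualSum_add_single`). If the iterated `q`-differences of `F` grow like `R^j`, the inner sum is
therefore `O(R^|k|)`. For `F = (αβ, αγ)_L / (αc, αd)_L` every `R` exceeding `max(1, |αβ|, |αγ|)` is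
admissible, by an exact formula for each quotient and a twisted Leibniz rule for their product. This
matches the three convergence conditions exactly.

Continuation. Multiplication by `∏ (α a_r x_r)_∞` makes each summand entire in every `a_r`, and the
previous bound gives normal convergence. The variables are freed one at a time: both sides are
analytic in `a_j` on a disc about `0` and agree at the points `q^(N+1)`, which accumulate at its
centre (`hasSum_regTerm`). -/

/-! ### Lagrange interpolation identities. -/

/-- The Lagrange coefficient `∏_{s ≠ r} (1 - y_r / y_s)⁻¹`. -/
noncomputable def lagCoeff {ι : Type*} [Fintype ι] [DecidableEq ι] (y : ι → ℂ) (r : ι) : ℂ :=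
  ∏ s, if s = r then 1 else (1 - y r / y s)⁻¹

/-- The polynomial `∏ (1 - p_t u)` has degree at most the number of `y_r`, so the `y_r` together
with `0` suffice to interpolate it. Comparing top coefficients gives the identity; the node `0`
contributes the constant `1`. -/
theorem sum_lagCoeff {ι : Type*} [Fintype ι] [DecidableEq ι] (y p : ι → ℂ)
    (hy : Function.Injective y) (hy0 : ∀ r, y r ≠ 0) :
    ∑ r, (∏ t, (1 - p t * y r)) * lagCoeff y r = 1 - ∏ t, p t * y t := by
  let v : Option ι → ℂ := fun o => o.elim 0 y
  let P : Polynomial ℂ := ∏ t, (1 - Polynomial.C (p t) * Polynomial.X)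
  have hv : Set.InjOn v ((Finset.univ : Finset (Option ι)) : Set (Option ι)) := by
    intro a _ b _ hab
    cases a <;> cases b <;> simp [v] at hab ⊢
    · exact hy0 _ hab.symm
    · exact hy0 _ hab
    · exact hy hab
  have hdeg1 : ∀ t, (1 - Polynomial.C (p t) * Polynomial.X : Polynomial ℂ).natDegree ≤ 1 := by
    intro t
    compute_degree
  have hdeg : P.natDegree ≤ Fintype.card ι := by
    refine (Polynomial.natDegree_prod_le _ _).trans ?_
    refine (Finset.sum_le_sum fun t _ => hdeg1 t).trans ?_
    simp
  have hP : P.degree < (Finset.univ : Finset (Option ι)).card := by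
    rw [Finset.card_univ, Fintype.card_option]
    refine lt_of_le_of_lt Polynomial.degree_le_natDegree ?_
    exact_mod_cast Nat.lt_succ_of_le hdeg
  have key := Lagrange.coeff_eq_sum hv hP
  have hcoeff : P.coeff (Fintype.card ι) = ∏ t, (-p t) := by
    have := Polynomial.coeff_prod_of_natDegree_le (Finset.univ : Finset ι)
      (fun t => (1 - Polynomial.C (p t) * Polynomial.X : Polynomial ℂ)) 1 (fun t _ => hdeg1 t)
    simp only [Finset.card_univ, mul_one] at this
    rw [this]
    refine Finset.prod_congr rfl fun t _ => ?_
    simp [Polynomial.coeff_one]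
  have heval : ∀ u, P.eval u = ∏ t, (1 - p t * u) := by
    intro u
    simp [P, Polynomial.eval_prod]
  have herase : ∀ i : Option ι, ∏ j ∈ Finset.univ.erase i, (v i - v j)
      = ∏ j, if j = i then 1 else (v i - v j) := by
    intro i
    rw [← Finset.mul_prod_erase Finset.univ _ (Finset.mem_univ i)]
    simp only [if_true, one_mul]
    refine Finset.prod_congr rfl fun j hj => ?_
    simp [(Finset.mem_erase.1 hj).1]
  rw [Finset.card_univ, Fintype.card_option, Nat.add_sub_cancel, hcoeff] at key
  simp only [herase, heval] at key
  simp only [Fintype.sum_option, Fintype.prod_option, v, Option.elim,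
    reduceCtorEq, if_false, if_true, one_mul, mul_zero, sub_zero, Finset.prod_const_one,
    Option.some.injEq, zero_sub] at key
  have hY : ∏ t, (-y t) ≠ 0 := Finset.prod_ne_zero_iff.2 fun t _ => neg_ne_zero.2 (hy0 t)
  have hlag : ∀ r, lagCoeff y r
      = - ((∏ t, (-y t)) / (y r * ∏ s, if s = r then 1 else (y r - y s))) := by
    intro r
    have h1 : ∏ t, (-y t) = (-y r) * ∏ s, if s = r then 1 else (- y s) := by
      rw [← Finset.mul_prod_erase Finset.univ _ (Finset.mem_univ r),
        ← Finset.mul_prod_erase Finset.univ (fun s => if s = r then 1 else (- y s))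
          (Finset.mem_univ r)]
      simp only [if_true, one_mul]
      congr 1
      refine Finset.prod_congr rfl fun j hj => ?_
      simp [(Finset.mem_erase.1 hj).1]
    rw [h1, neg_mul, neg_div, neg_neg, mul_div_mul_left _ _ (hy0 r), ← Finset.prod_div_distrib]
    refine Finset.prod_congr rfl fun s _ => ?_
    split_ifs with h
    · simp
    · have : y s - y r ≠ 0 := sub_ne_zero.2 fun h' => h (hy h')
      have h2 : y r - y s ≠ 0 := sub_ne_zero.2 fun h' => h (hy h'.symm)
      have h3 := hy0 s
      rw [one_sub_div h3, inv_div, div_eq_div_iff this h2]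
      ring
  have h4 : ∏ t, p t * y t = (∏ t, (-p t)) * ∏ t, (-y t) := by
    rw [← Finset.prod_mul_distrib]
    exact Finset.prod_congr rfl fun t _ => by ring
  rw [h4, key, add_mul, Finset.sum_mul, div_mul_cancel₀ _ hY]
  rw [sub_add_eq_sub_sub, sub_self, zero_sub, ← Finset.sum_neg_distrib]
  refine Finset.sum_congr rfl fun r _ => ?_
  rw [hlag r]
  ring

/-- This is `sum_lagCoeff` with an additional node `κ⁻¹` and an additional parameter `ε * κ`,
multiplied by `∏ (1 - κ y_s)`. The additional node produces the term with `1 - ε`. -/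
theorem sum_lagCoeff_mul_prod {ι : Type*} [Fintype ι] [DecidableEq ι] (y p : ι → ℂ)
    (hy : Function.Injective y) (hy0 : ∀ r, y r ≠ 0) (ε κ : ℂ) :
    ∑ r, (∏ t, (1 - p t * y r)) * (1 - ε * κ * y r)
        * (∏ s, if s = r then 1 else (1 - κ * y s)) * lagCoeff y r
      = (∏ s, (1 - κ * y s)) * (1 - ε * ∏ t, p t * y t)
        - (1 - ε) * ∏ t, (p t - κ) * y t := by
  -- The additional node must be finite and distinct from the `y_r`. The excluded `κ` form a finite
  -- set, and both sides are continuous in `κ`, so density covers them.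
  have hcount : (insert 0 (Set.range fun r => (y r)⁻¹)).Countable :=
    ((Set.finite_range _).insert 0).countable
  refine congrFun (Continuous.ext_on (hcount.dense_compl ℂ)
    (f := fun κ => ∑ r, (∏ t, (1 - p t * y r)) * (1 - ε * κ * y r)
        * (∏ s, if s = r then 1 else (1 - κ * y s)) * lagCoeff y r)
    (g := fun κ => (∏ s, (1 - κ * y s)) * (1 - ε * ∏ t, p t * y t)
        - (1 - ε) * ∏ t, (p t - κ) * y t) ?_ (by fun_prop) ?_) κ
  · refine continuous_finsetSum _ fun r _ => ?_
    refine Continuous.mul (Continuous.mul (by fun_prop) ?_) continuous_const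
    refine continuous_finsetProd _ fun s _ => ?_
    split_ifs <;> fun_prop
  intro κ hκ
  simp only [Set.mem_compl_iff, Set.mem_insert_iff, Set.mem_range, not_or, not_exists] at hκ
  obtain ⟨hκ0, hκy⟩ := hκ
  have hne : ∀ s, 1 - κ * y s ≠ 0 := fun s h => hκy s (by
    have := hy0 s
    field_simp
    linear_combination h)
  have hne' : ∀ s, κ * y s - 1 ≠ 0 := fun s h => hne s (by linear_combination -h)
  let v : Option ι → ℂ := fun o => o.elim κ⁻¹ y
  let P : Option ι → ℂ := fun o => o.elim (ε * κ) p
  have hv : Function.Injective v := by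
    intro a b hab
    cases a <;> cases b <;> simp [v] at hab ⊢
    · rename_i b; exact hκy b (by rw [← hab, inv_inv])
    · rename_i b; exact hκy b (by rw [hab, inv_inv])
    · exact hy hab
  have hv0 : ∀ o, v o ≠ 0 := by
    intro o; cases o <;> simp [v, hκ0, hy0]
  have key := sum_lagCoeff v P hv hv0
  simp only [lagCoeff, Fintype.sum_option, Fintype.prod_option, v, P, Option.elim,
    reduceCtorEq, if_false, if_true, one_mul, Option.some.injEq] at key
  have e1 : (∏ s, (1 - κ * y s)) * ((1 - ε * κ * κ⁻¹) * (∏ t, (1 - p t * κ⁻¹))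
      * ∏ s, (1 - κ⁻¹ / y s)⁻¹) = (1 - ε) * ∏ t, (p t - κ) * y t := by
    rw [mul_assoc ε, mul_inv_cancel₀ hκ0, mul_one]
    rw [show ∀ A B C D : ℂ, A * (B * C * D) = B * (A * C * D) by intros; ring,
      ← Finset.prod_mul_distrib, ← Finset.prod_mul_distrib]
    congr 1
    refine Finset.prod_congr rfl fun t _ => ?_
    have h1 := hy0 t
    have h2 := hne' t
    have h3 : 1 - κ⁻¹ / y t = (κ * y t - 1) / (κ * y t) := by field_simp
    rw [h3, inv_div]
    field_simp
    ring
  have e2 : ∀ r, (∏ s, (1 - κ * y s)) * ((1 - ε * κ * y r) * (∏ t, (1 - p t * y r))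
      * ((1 - y r / κ⁻¹)⁻¹ * ∏ s, if s = r then 1 else (1 - y r / y s)⁻¹))
      = (∏ t, (1 - p t * y r)) * (1 - ε * κ * y r)
        * (∏ s, if s = r then 1 else (1 - κ * y s))
        * ∏ s, if s = r then 1 else (1 - y r / y s)⁻¹ := by
    intro r
    have h1 : ∏ s, (1 - κ * y s) = (1 - κ * y r) * ∏ s, if s = r then 1 else (1 - κ * y s) := by
      rw [← Finset.mul_prod_erase Finset.univ _ (Finset.mem_univ r),
        ← Finset.mul_prod_erase Finset.univ (fun s => if s = r then 1 else (1 - κ * y s))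
          (Finset.mem_univ r)]
      simp only [if_true, one_mul]
      congr 1
      refine Finset.prod_congr rfl fun j hj => ?_
      simp [(Finset.mem_erase.1 hj).1]
    have h2 := hne r
    rw [h1, div_inv_eq_mul, mul_comm (y r) κ]
    field_simp
  have e3 : ε * κ * κ⁻¹ * ∏ t, p t * y t = ε * ∏ t, p t * y t := by
    rw [mul_assoc ε, mul_inv_cancel₀ hκ0, mul_one]
  rw [e3] at key
  have key2 := congrArg (fun z => (∏ s, (1 - κ * y s)) * z) key
  simp only [mul_add, Finset.mul_sum, e1, e2] at key2
  simp only [lagCoeff]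
  rw [← key2]
  ring

/-! ### Finite `q`-shifted factorials and generic parameters. -/

theorem qPoch_succ (q z : ℂ) (k : ℕ) : qPoch q z (k + 1) = qPoch q z k * (1 - z * q ^ k) :=
  Finset.prod_range_succ _ _

theorem qPoch_zero (q z : ℂ) : qPoch q z 0 = 1 := Finset.prod_range_zero _

theorem qPoch_add (q z : ℂ) (k l : ℕ) :
    qPoch q z (k + l) = qPoch q z k * qPoch q (z * q ^ k) l := by
  rw [qPoch, Finset.prod_range_add, qPoch, qPoch]
  congr 1
  exact Finset.prod_congr rfl fun i _ => by rw [pow_add, mul_assoc]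

theorem qPoch_succ' (q z : ℂ) (k : ℕ) : qPoch q z (k + 1) = (1 - z) * qPoch q (z * q) k := by
  rw [add_comm, qPoch_add, pow_one]
  simp [qPoch]

/-- The points `x_r q^{m_r}`. -/
def qNode {n : ℕ} (q : ℂ) (x : Fin n → ℂ) (m : Fin n → ℕ) (r : Fin n) : ℂ := x r * q ^ m r

/-- The parameters `x_r` are nonzero and pairwise incongruent modulo integral powers of `q`, and
`q` is neither zero nor a root of unity. -/
structure QGeneric {n : ℕ} (q : ℂ) (x : Fin n → ℂ) : Prop where
  q_ne : q ≠ 0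
  pow_ne : ∀ k : ℕ, q ^ (k + 1) ≠ 1
  x_ne : ∀ r, x r ≠ 0
  inj : ∀ r s, r ≠ s → ∀ i j : ℕ, x r * q ^ i ≠ x s * q ^ j

namespace QGeneric

variable {n : ℕ} {q : ℂ} {x : Fin n → ℂ}

theorem qNode_ne (h : QGeneric q x) (m : Fin n → ℕ) (r : Fin n) : qNode q x m r ≠ 0 :=
  mul_ne_zero (h.x_ne r) (pow_ne_zero _ h.q_ne)

theorem qNode_injective (h : QGeneric q x) (m : Fin n → ℕ) :
    Function.Injective (qNode q x m) := fun r s hrs => by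
  by_contra hne
  exact h.inj r s hne _ _ hrs

theorem shift (h : QGeneric q x) (m : Fin n → ℕ) : QGeneric q (qNode q x m) where
  q_ne := h.q_ne
  pow_ne := h.pow_ne
  x_ne := h.qNode_ne m
  inj := fun r s hrs i j => by
    rw [qNode, qNode, mul_assoc, mul_assoc, ← pow_add, ← pow_add]
    exact h.inj r s hrs _ _

theorem one_sub_ne (h : QGeneric q x) (r s : Fin n) (i : ℕ) :
    1 - q * x r / x s * q ^ i ≠ 0 := by
  intro h0
  have hs := h.x_ne s
  have h1 : x r * q ^ (i + 1) = x s * q ^ 0 := by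
    field_simp at h0
    rw [pow_succ]
    linear_combination -h0
  by_cases hrs : r = s
  · subst hrs
    exact h.pow_ne i (mul_left_cancel₀ hs (by rw [h1, pow_zero]))
  · exact h.inj r s hrs _ _ h1

theorem qPoch_ne (h : QGeneric q x) (r s : Fin n) (k : ℕ) : qPoch q (q * x r / x s) k ≠ 0 :=
  Finset.prod_ne_zero_iff.2 fun i _ => h.one_sub_ne r s i

theorem sub_ne (h : QGeneric q x) {r s : Fin n} (hrs : r ≠ s) : x r - x s ≠ 0 :=
  sub_ne_zero.2 fun h' => h.inj r s hrs 0 0 (by simpa using h')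

end QGeneric

/-! ### Vandermonde quotients and the basic `A_n` weight. -/

/-- Puts a product over `s ≠ r` in the shape of a Vandermonde product, so that the two can be
compared pair by pair when only the `r`-th node moves. -/
theorem prod_ite_eq_prod_pairs {n : ℕ} (r : Fin n) (h : Fin n → ℂ) :
    (∏ s, if s = r then 1 else h s)
      = ∏ i, ∏ j ∈ Finset.Ioi i, if i = r then h j else if j = r then h i else 1 := by
  have h1 : ∀ i, (∏ j ∈ Finset.Ioi i, if i = r then h j else if j = r then h i else 1)
      = (if i = r then ∏ j ∈ Finset.Ioi r, h j else 1) * (if i < r then h i else 1) := by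
    intro i
    rcases lt_trichotomy i r with hi | hi | hi
    · rw [if_neg hi.ne, if_pos hi, one_mul]
      simp only [if_neg hi.ne]
      rw [Finset.prod_ite_eq', if_pos (Finset.mem_Ioi.2 hi)]
    · subst hi
      simp
    · rw [if_neg hi.ne', if_neg hi.not_gt, one_mul]
      refine Finset.prod_eq_one fun j hj => ?_
      rw [if_neg hi.ne', if_neg (hi.trans (Finset.mem_Ioi.1 hj)).ne']
  simp only [h1]
  rw [Finset.prod_mul_distrib, Finset.prod_ite_eq' Finset.univ r, if_pos (Finset.mem_univ r)]
  have h2 : ∏ j ∈ Finset.Ioi r, h j = ∏ j, if r < j then h j else 1 := by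
    rw [← Finset.prod_filter]
    congr 1
    ext j
    simp
  rw [h2, ← Finset.prod_mul_distrib]
  refine Finset.prod_congr rfl fun s _ => ?_
  rcases lt_trichotomy s r with hi | hi | hi
  · simp [hi, hi.ne, hi.not_gt]
  · simp [hi]
  · simp [hi, hi.ne', hi.not_gt]

/-- The quotient of Vandermonde products `∏_{r < s} (x_r q^{m_r} - x_s q^{m_s}) / (x_r - x_s)`. -/
noncomputable def vdmQuot {n : ℕ} (q : ℂ) (x : Fin n → ℂ) (m : Fin n → ℕ) : ℂ :=
  ∏ r, ∏ s ∈ Finset.Ioi r, (qNode q x m r - qNode q x m s) / (x r - x s)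

theorem qNode_add_single {n : ℕ} (q : ℂ) (x : Fin n → ℂ) (m : Fin n → ℕ) (r s : Fin n) :
    qNode q x (m + Pi.single r 1) s = if s = r then q * qNode q x m r else qNode q x m s := by
  by_cases h : s = r
  · subst h
    simp [qNode, pow_succ]
    ring
  · simp [qNode, h]

theorem vdmQuot_add_single {n : ℕ} (q : ℂ) (x : Fin n → ℂ) (m : Fin n → ℕ) (r : Fin n) :
    vdmQuot q x (m + Pi.single r 1)
        * (∏ s, if s = r then 1 else (qNode q x m r - qNode q x m s))
      = vdmQuot q x m * ∏ s, if s = r then 1 else (q * qNode q x m r - qNode q x m s) := by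
  rw [prod_ite_eq_prod_pairs, prod_ite_eq_prod_pairs, vdmQuot, vdmQuot,
    ← Finset.prod_mul_distrib, ← Finset.prod_mul_distrib]
  refine Finset.prod_congr rfl fun i _ => ?_
  rw [← Finset.prod_mul_distrib, ← Finset.prod_mul_distrib]
  refine Finset.prod_congr rfl fun j hj => ?_
  have hij := (Finset.mem_Ioi.1 hj).ne'
  rw [qNode_add_single, qNode_add_single]
  by_cases hi : i = r
  · subst hi
    simp only [if_true, if_neg hij]
    ring
  · by_cases hj' : j = r
    · subst hj'
      simp only [if_true, if_neg hi]
      ring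
    · simp only [if_neg hi, if_neg hj']

theorem vdmQuot_add {n : ℕ} {q : ℂ} {x : Fin n → ℂ} (hx : QGeneric q x) (m j : Fin n → ℕ) :
    vdmQuot q x (m + j) = vdmQuot q x m * vdmQuot q (qNode q x m) j := by
  rw [vdmQuot, vdmQuot, vdmQuot, ← Finset.prod_mul_distrib]
  refine Finset.prod_congr rfl fun r _ => ?_
  rw [← Finset.prod_mul_distrib]
  refine Finset.prod_congr rfl fun s hs => ?_
  have h1 := (hx.shift m).sub_ne (Finset.mem_Ioi.1 hs).ne
  have h2 : ∀ r, qNode q (qNode q x m) j r = qNode q x (m + j) r := fun r => by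
    simp [qNode, pow_add, mul_assoc]
  rw [h2, h2, mul_comm, div_mul_div_cancel₀ h1]

theorem vdmQuot_zero {n : ℕ} {q : ℂ} {x : Fin n → ℂ} (hx : QGeneric q x) :
    vdmQuot q x 0 = 1 := by
  refine Finset.prod_eq_one fun r _ => Finset.prod_eq_one fun s hs => ?_
  simp only [qNode, Pi.zero_apply, pow_zero, mul_one]
  exact div_self (hx.sub_ne (Finset.mem_Ioi.1 hs).ne)

/-- The basic summand of an `A_n` multiple basic hypergeometric series. -/
noncomputable def anWeight {n : ℕ} (q : ℂ) (x w : Fin n → ℂ) (m : Fin n → ℕ) : ℂ :=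
  vdmQuot q x m * ∏ r, ∏ s, qPoch q (x r / w s) (m r) / qPoch q (q * x r / x s) (m r)

theorem anWeight_zero {n : ℕ} {q : ℂ} {x : Fin n → ℂ} (hx : QGeneric q x) (w : Fin n → ℂ) :
    anWeight q x w 0 = 1 := by
  simp [anWeight, vdmQuot_zero hx, qPoch_zero]

theorem prod_apply_add_single {n : ℕ} {M : Type*} [CommMonoid M] (f : Fin n → ℕ → M)
    (g : Fin n → M) (m : Fin n → ℕ) (r : Fin n) (h : f r (m r + 1) = f r (m r) * g r) :
    ∏ i, f i ((m + Pi.single r 1 : Fin n → ℕ) i) = (∏ i, f i (m i)) * g r := by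
  rw [← Finset.mul_prod_erase Finset.univ _ (Finset.mem_univ r),
    ← Finset.mul_prod_erase Finset.univ (fun i => f i (m i)) (Finset.mem_univ r)]
  simp only [Pi.add_apply, Pi.single_eq_same, h]
  rw [mul_right_comm]
  congr 2
  refine Finset.prod_congr rfl fun i hi => ?_
  simp [(Finset.mem_erase.1 hi).1]

theorem anWeight_add_single {n : ℕ} {q : ℂ} {x : Fin n → ℂ} (hx : QGeneric q x)
    (w : Fin n → ℂ) (m : Fin n → ℕ) (r : Fin n) :
    anWeight q x w (m + Pi.single r 1) * (∏ s, (1 - q * qNode q x m r / x s))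
        * (∏ s, if s = r then 1 else (qNode q x m r - qNode q x m s))
      = anWeight q x w m * (∏ s, (1 - qNode q x m r / w s))
        * ∏ s, if s = r then 1 else (q * qNode q x m r - qNode q x m s) := by
  have h1 := prod_apply_add_single
    (fun i k => ∏ s, qPoch q (x i / w s) k / qPoch q (q * x i / x s) k)
    (fun i => (∏ s, (1 - qNode q x m i / w s)) / ∏ s, (1 - q * qNode q x m i / x s)) m r (by
      rw [← Finset.prod_div_distrib, ← Finset.prod_mul_distrib]
      refine Finset.prod_congr rfl fun s _ => ?_
      rw [qPoch_succ, qPoch_succ, mul_div_mul_comm]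
      congr 3 <;> simp only [qNode] <;> ring)
  have h2 : ∏ s, (1 - q * qNode q x m r / x s) ≠ 0 :=
    Finset.prod_ne_zero_iff.2 fun s _ => by
      have := hx.one_sub_ne r s (m r)
      rwa [div_mul_eq_mul_div, mul_assoc] at this
  have h3 := vdmQuot_add_single q x m r
  rw [anWeight, h1, anWeight]
  calc _ = (vdmQuot q x (m + Pi.single r 1)
        * (∏ s, if s = r then 1 else (qNode q x m r - qNode q x m s)))
        * (∏ r, ∏ s, qPoch q (x r / w s) (m r) / qPoch q (q * x r / x s) (m r))
        * ((∏ s, (1 - qNode q x m r / w s)) / (∏ s, (1 - q * qNode q x m r / x s))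
        * (∏ s, (1 - q * qNode q x m r / x s))) := by ring
    _ = _ := by
      rw [h3, div_mul_cancel₀ _ h2]
      ring

/-- The engine of all level recurrences: the same expression, with `w` replaced by `x`, reappears at
`m + e_r`. Both sides can then be summed over `r` by interpolation at their own nodes. -/
theorem anWeight_transfer {n : ℕ} {q : ℂ} {x : Fin n → ℂ} (hx : QGeneric q x)
    (w : Fin n → ℂ) (m : Fin n → ℕ) (r : Fin n) :
    anWeight q x w m * (∏ s, (1 - qNode q x m r / w s)) * lagCoeff (qNode q x m) r
      = anWeight q x w (m + Pi.single r 1)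
        * (∏ s, (1 - qNode q x (m + Pi.single r 1) r / x s))
        * lagCoeff (qNode q x (m + Pi.single r 1)) r := by
  have key := anWeight_add_single hx w m r
  have hlag : ∀ m : Fin n → ℕ, lagCoeff (qNode q x m) r
      * (∏ s, if s = r then 1 else (qNode q x m r - qNode q x m s))
      = ∏ s, if s = r then 1 else (- qNode q x m s) := by
    intro m
    rw [lagCoeff, ← Finset.prod_mul_distrib]
    refine Finset.prod_congr rfl fun s _ => ?_
    by_cases hs : s = r
    · simp [hs]
    · simp only [if_neg hs]
      have h1 := hx.qNode_ne m s
      have h2 := (hx.shift m).sub_ne (Ne.symm hs)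
      have h3 := (hx.shift m).sub_ne hs
      rw [one_sub_div h1, inv_div, div_mul_eq_mul_div, div_eq_iff h3]
      ring
  have hne : ∀ m : Fin n → ℕ,
      (∏ s, if s = r then 1 else (qNode q x m r - qNode q x m s)) ≠ 0 := by
    intro m
    refine Finset.prod_ne_zero_iff.2 fun s _ => ?_
    split_ifs with hs
    · exact one_ne_zero
    · exact (hx.shift m).sub_ne (Ne.symm hs)
  have e1 := hlag m
  have e2 := hlag (m + Pi.single r 1)
  have n1 := hne m
  have n2 := hne (m + Pi.single r 1)
  have e3 : (∏ s, if s = r then 1 else (- qNode q x (m + Pi.single r 1) s))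
      = ∏ s, if s = r then 1 else (- qNode q x m s) := by
    refine Finset.prod_congr rfl fun s _ => ?_
    by_cases hs : s = r
    · simp [hs]
    · simp only [if_neg hs]
      rw [qNode_add_single, if_neg hs]
  have e4 : (∏ s, if s = r then 1 else (qNode q x (m + Pi.single r 1) r
        - qNode q x (m + Pi.single r 1) s))
      = ∏ s, if s = r then 1 else (q * qNode q x m r - qNode q x m s) := by
    refine Finset.prod_congr rfl fun s _ => ?_
    by_cases hs : s = r
    · simp [hs]
    · simp only [if_neg hs]
      rw [qNode_add_single, qNode_add_single, if_neg hs, if_pos rfl]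
  have e5 : qNode q x (m + Pi.single r 1) r = q * qNode q x m r := by
    rw [qNode_add_single, if_pos rfl]
  rw [e4] at e2 n2
  rw [e3] at e2
  rw [e5]
  refine mul_right_cancel₀ (mul_ne_zero n1 n2) ?_
  linear_combination
    (anWeight q x w m * (∏ s, (1 - qNode q x m r / w s))
      * (∏ s, if s = r then 1 else (q * qNode q x m r - qNode q x m s))) * e1
    - (anWeight q x w (m + Pi.single r 1) * (∏ s, (1 - q * qNode q x m r / x s))
      * (∏ s, if s = r then 1 else (qNode q x m r - qNode q x m s))) * e2
    - (∏ s, if s = r then 1 else (- qNode q x m s)) * key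

/-! ### Summation over the levels `|m| = L`. -/

/-- The map `(m, r) ↦ (m + e_r, r)` is injective, and it misses exactly the pairs with `m_r = 0` on
the next level, where `G'` vanishes. -/
theorem sum_piAntidiag_single_shift {n : ℕ} (L : ℕ) (G G' : (Fin n → ℕ) → Fin n → ℂ)
    (h : ∀ m r, G m r = G' (m + Pi.single r 1) r) (h0 : ∀ m r, m r = 0 → G' m r = 0) :
    ∑ m ∈ Finset.piAntidiag Finset.univ L, ∑ r, G m r
      = ∑ m ∈ Finset.piAntidiag Finset.univ (L + 1), ∑ r, G' m r := by
  rw [← Finset.sum_product', ← Finset.sum_product']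
  have hs : ∀ (m : Fin n → ℕ) (r : Fin n), (∑ i, (m + Pi.single r 1 : Fin n → ℕ) i) = (∑ i, m i) + 1 := by
    intro m r
    simp [Finset.sum_add_distrib]
  have hinv : ∀ (m : Fin n → ℕ) (r : Fin n), m r ≠ 0 → m - Pi.single r 1 + Pi.single r 1 = m := by
    intro m r hm
    ext i
    by_cases hi : i = r
    · subst hi
      simp only [Pi.add_apply, Pi.sub_apply, Pi.single_eq_same]
      omega
    · simp [hi]
  refine Finset.sum_bij_ne_zero (fun p _ _ => (p.1 + Pi.single p.2 1, p.2)) ?_ ?_ ?_ ?_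
  · intro p hp _
    simp only [Finset.mem_product, Finset.mem_piAntidiag, Finset.mem_univ, and_true,
      implies_true] at hp ⊢
    rw [hs, hp]
  · intro p _ _ p' _ _ hpp
    simp only [Prod.mk.injEq] at hpp
    obtain ⟨h1, h2⟩ := hpp
    rw [h2] at h1
    exact Prod.ext (add_right_cancel h1) h2
  · intro p hp hne
    have hp0 : p.1 p.2 ≠ 0 := fun h' => hne (h0 _ _ h')
    refine ⟨(p.1 - Pi.single p.2 1, p.2), ?_, ?_, ?_⟩
    · simp only [Finset.mem_product, Finset.mem_piAntidiag, Finset.mem_univ, and_true,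
        implies_true] at hp ⊢
      have := hs (p.1 - Pi.single p.2 1) p.2
      rw [hinv _ _ hp0, hp] at this
      exact (Nat.succ.inj this).symm
    · rw [h, hinv _ _ hp0]
      exact hne
    · rw [hinv _ _ hp0]
  · intro p _ _
    exact h _ _

theorem prod_qNode_div {n : ℕ} {q : ℂ} {x : Fin n → ℂ} (hx : QGeneric q x) (m : Fin n → ℕ) :
    ∏ t, (x t)⁻¹ * qNode q x m t = q ^ ∑ t, m t := by
  rw [← Finset.prod_pow_eq_pow_sum]
  refine Finset.prod_congr rfl fun t _ => ?_
  rw [qNode, inv_mul_cancel_left₀ (hx.x_ne t)]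

theorem prod_inv_sub_mul_qNode {n : ℕ} {q : ℂ} {x : Fin n → ℂ} (hx : QGeneric q x)
    (w : Fin n → ℂ) (hw : ∀ r, w r ≠ 0) (m : Fin n → ℕ) (z : ℂ) :
    ∏ t, ((w t)⁻¹ - z) * qNode q x m t
      = (∏ t, x t / w t) * (q ^ ∑ t, m t) * ∏ t, (1 - z * w t) := by
  rw [← prod_qNode_div hx, ← Finset.prod_mul_distrib, ← Finset.prod_mul_distrib]
  refine Finset.prod_congr rfl fun t _ => ?_
  have h1 := hx.x_ne t
  have h2 := hw t
  field_simp

theorem prod_eq_mul_prod_ite {ι : Type*} [Fintype ι] [DecidableEq ι] (f : ι → ℂ) (r : ι) :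
    ∏ s, f s = f r * ∏ s, if s = r then 1 else f s := by
  rw [← Finset.mul_prod_erase Finset.univ _ (Finset.mem_univ r),
    ← Finset.mul_prod_erase Finset.univ (fun s => if s = r then 1 else f s) (Finset.mem_univ r)]
  simp only [if_true, one_mul]
  congr 1
  refine Finset.prod_congr rfl fun j hj => ?_
  simp [(Finset.mem_erase.1 hj).1]

theorem prod_one_sub_eq_zero {n : ℕ} {q : ℂ} {x : Fin n → ℂ} (hx : QGeneric q x)
    (m : Fin n → ℕ) (r : Fin n) (h : m r = 0) : ∏ s, (1 - qNode q x m r / x s) = 0 := by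
  refine Finset.prod_eq_zero (Finset.mem_univ r) ?_
  rw [qNode, h, pow_zero, mul_one, div_self (hx.x_ne r), sub_self]

/-- The transferred terms are summed over `r` by `sum_lagCoeff_mul_prod` with `ε = 0`, taking `p =
1/w` on level `L` and `p = 1/x` on level `L + 1`. -/
theorem sum_mul_prod_one_sub_recurrence {n : ℕ} {q : ℂ} {x : Fin n → ℂ} (hx : QGeneric q x)
    (w : Fin n → ℂ) (hw : ∀ r, w r ≠ 0) (z : ℂ) (L : ℕ) :
    (∑ m ∈ Finset.piAntidiag Finset.univ (L + 1),
        anWeight q x w m * ∏ s, (1 - z * qNode q x m s))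
      - q ^ (L + 1) * (∏ s, (1 - z * x s))
        * ∑ m ∈ Finset.piAntidiag Finset.univ (L + 1), anWeight q x w m
    = (∑ m ∈ Finset.piAntidiag Finset.univ L,
        anWeight q x w m * ∏ s, (1 - z * qNode q x m s))
      - (∏ t, x t / w t) * q ^ L * (∏ s, (1 - z * w s))
        * ∑ m ∈ Finset.piAntidiag Finset.univ L, anWeight q x w m := by
  have key := sum_piAntidiag_single_shift L
    (fun m r => anWeight q x w m * (∏ s, (1 - qNode q x m r / w s))
      * (∏ s, if s = r then 1 else (1 - z * qNode q x m s)) * lagCoeff (qNode q x m) r)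
    (fun m r => anWeight q x w m * (∏ s, (1 - qNode q x m r / x s))
      * (∏ s, if s = r then 1 else (1 - z * qNode q x m s)) * lagCoeff (qNode q x m) r)
    (fun m r => by
      have h1 := anWeight_transfer hx w m r
      have h2 : (∏ s, if s = r then 1 else (1 - z * qNode q x (m + Pi.single r 1) s))
          = ∏ s, if s = r then 1 else (1 - z * qNode q x m s) := by
        refine Finset.prod_congr rfl fun s _ => ?_
        by_cases hs : s = r
        · simp [hs]
        · simp only [if_neg hs, qNode_add_single]
      simp only [h2]
      linear_combination (∏ s, if s = r then 1 else (1 - z * qNode q x m s)) * h1)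
    (fun m r h => by simp only [prod_one_sub_eq_zero hx m r h]; ring)
  have h1 : ∀ (u : Fin n → ℂ) (_ : ∀ r, u r ≠ 0) (m : Fin n → ℕ),
      ∑ r, anWeight q x w m * (∏ s, (1 - qNode q x m r / u s))
        * (∏ s, if s = r then 1 else (1 - z * qNode q x m s)) * lagCoeff (qNode q x m) r
      = anWeight q x w m * (∏ s, (1 - z * qNode q x m s))
        - (∏ t, x t / u t) * q ^ (∑ t, m t) * (∏ s, (1 - z * u s)) * anWeight q x w m := by
    intro u hu m
    have h2 := sum_lagCoeff_mul_prod (qNode q x m) (fun t => (u t)⁻¹)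
      (hx.qNode_injective m) (hx.qNode_ne m) 0 z
    rw [prod_inv_sub_mul_qNode hx u hu] at h2
    simp only [zero_mul, sub_zero, mul_one, one_mul] at h2
    rw [mul_comm _ (anWeight q x w m), ← mul_sub, ← h2, Finset.mul_sum]
    refine Finset.sum_congr rfl fun r _ => ?_
    simp only [div_eq_inv_mul]
    ring
  simp only [h1 w hw, h1 x hx.x_ne, Finset.sum_sub_distrib] at key
  have h3 : ∀ (u : Fin n → ℂ) (L : ℕ), ∑ m ∈ Finset.piAntidiag Finset.univ L,
      (∏ t, x t / u t) * q ^ (∑ t, m t) * (∏ s, (1 - z * u s)) * anWeight q x w m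
      = (∏ t, x t / u t) * q ^ L * (∏ s, (1 - z * u s))
        * ∑ m ∈ Finset.piAntidiag Finset.univ L, anWeight q x w m := by
    intro u L
    rw [Finset.mul_sum]
    refine Finset.sum_congr rfl fun m hm => ?_
    rw [(Finset.mem_piAntidiag.1 hm).1]
  have h4 : ∏ t, x t / x t = 1 := Finset.prod_eq_one fun t _ => div_self (hx.x_ne t)
  rw [h3, h3, h4, one_mul] at key
  exact key.symm

theorem qPoch_self_ne {q : ℂ} (hq : ∀ k : ℕ, q ^ (k + 1) ≠ 1) (L : ℕ) : qPoch q q L ≠ 0 :=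
  Finset.prod_ne_zero_iff.2 fun i _ => by
    rw [← pow_succ']
    exact sub_ne_zero.2 (hq i).symm

/-- At `z = 0` the recurrence closes: `(1 - q^(L+1)) S(L+1) = (1 - A q^L) S(L)`, where `A = ∏ x_t /
w_t`. -/
theorem sum_anWeight {n : ℕ} {q : ℂ} {x : Fin n → ℂ} (hx : QGeneric q x)
    (w : Fin n → ℂ) (hw : ∀ r, w r ≠ 0) (L : ℕ) :
    ∑ m ∈ Finset.piAntidiag Finset.univ L, anWeight q x w m
      = qPoch q (∏ t, x t / w t) L / qPoch q q L := by
  induction L with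
  | zero => simp [anWeight_zero hx, qPoch_zero]
  | succ L ih =>
    have h := sum_mul_prod_one_sub_recurrence hx w hw 0 L
    simp only [zero_mul, sub_zero, Finset.prod_const_one, mul_one] at h
    have hq := qPoch_self_ne hx.pow_ne L
    have hq' : 1 - q * q ^ L ≠ 0 := by
      rw [← pow_succ']
      exact sub_ne_zero.2 (hx.pow_ne L).symm
    rw [ih] at h
    rw [qPoch_succ, qPoch_succ, eq_div_iff (mul_ne_zero hq hq')]
    linear_combination qPoch q q L * h
      + (1 - (∏ t, x t / w t) * q ^ L) * div_mul_cancel₀ (qPoch q (∏ t, x t / w t) L) hq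

theorem sum_anWeight_mul_prod {n : ℕ} {q : ℂ} {x : Fin n → ℂ} (hx : QGeneric q x)
    (w : Fin n → ℂ) (hw : ∀ r, w r ≠ 0) (z : ℂ) (L : ℕ) :
    ∑ m ∈ Finset.piAntidiag Finset.univ (L + 1),
        anWeight q x w m * ∏ s, (1 - z * qNode q x m s)
      = qPoch q ((∏ t, x t / w t) * q) (L + 1) / qPoch q q (L + 1) * (∏ s, (1 - z * x s))
        - (∏ t, x t / w t) * (qPoch q ((∏ t, x t / w t) * q) L / qPoch q q L)
          * ∏ s, (1 - z * w s) := by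
  -- With `u(L) = (Aq)_L / (q)_L`, the level sum of `anWeight` is the increment of `u` divided by
  -- `q^L`. The recurrence for general `z` therefore integrates explicitly.
  have hu : ∀ L, qPoch q ((∏ t, x t / w t) * q) (L + 1) / qPoch q q (L + 1)
      - qPoch q ((∏ t, x t / w t) * q) L / qPoch q q L
      = q ^ (L + 1) * (qPoch q (∏ t, x t / w t) (L + 1) / qPoch q q (L + 1)) := by
    intro L
    have hq := qPoch_self_ne hx.pow_ne L
    have hq' : 1 - q * q ^ L ≠ 0 := by
      rw [← pow_succ']
      exact sub_ne_zero.2 (hx.pow_ne L).symm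
    rw [qPoch_succ' q (∏ t, x t / w t), qPoch_succ, qPoch_succ q q]
    field_simp
    ring
  induction L with
  | zero =>
    have h := sum_mul_prod_one_sub_recurrence hx w hw z 0
    rw [sum_anWeight hx w hw, sum_anWeight hx w hw] at h
    simp only [Finset.piAntidiag_zero, Finset.sum_singleton, anWeight_zero hx, qPoch_zero,
      div_one, pow_zero, mul_one, one_mul, qNode, Pi.zero_apply] at h
    have h2 := hu 0
    simp only [qPoch_zero, div_one] at h2
    simp only [qPoch_zero, div_one, qNode]
    linear_combination h - (∏ s, (1 - z * x s)) * h2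
  | succ L ih =>
    have h := sum_mul_prod_one_sub_recurrence hx w hw z (L + 1)
    rw [sum_anWeight hx w hw, sum_anWeight hx w hw, ih] at h
    linear_combination h - (∏ s, (1 - z * x s)) * hu (L + 1)
      + (∏ t, x t / w t) * (∏ s, (1 - z * w s)) * hu L

/-! ### Contiguous relation of the inner series in the outer index `k`. -/

/-- The level sums `∑_{|m| = L}` of the inner series. -/
noncomputable def dualLevel {n : ℕ} (q a c : ℂ) (x : Fin n → ℂ) (k : Fin n → ℕ) (L : ℕ) : ℂ :=
  ∑ m ∈ Finset.piAntidiag Finset.univ L,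
    anWeight q x (qNode q x k) m * ∏ r, qPoch q (a * x r) (m r) / qPoch q (c * x r) (m r)

theorem anWeight_qNode_add_single {n : ℕ} {q : ℂ} {x : Fin n → ℂ} (hx : QGeneric q x)
    (k m : Fin n → ℕ) (s : Fin n) :
    anWeight q x (qNode q x k) m * ∏ r, (1 - x r / (q * qNode q x k s))
      = anWeight q x (qNode q x (k + Pi.single s 1)) m
        * ∏ r, (1 - qNode q x m r / (q * qNode q x k s)) := by
  rw [anWeight, anWeight, mul_assoc, mul_assoc, ← Finset.prod_mul_distrib,
    ← Finset.prod_mul_distrib]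
  refine congrArg (vdmQuot q x m * ·) ?_
  refine Finset.prod_congr rfl fun r _ => ?_
  have e0 := prod_eq_mul_prod_ite (fun t => qPoch q (x r / qNode q x (k + Pi.single s 1) t) (m r)
    / qPoch q (q * x r / x t) (m r)) s
  have e1 := prod_eq_mul_prod_ite (fun t => qPoch q (x r / qNode q x k t) (m r)
    / qPoch q (q * x r / x t) (m r)) s
  simp only [e0, e1]
  have h1 : (∏ t, if t = s then 1 else qPoch q (x r / qNode q x (k + Pi.single s 1) t) (m r)
      / qPoch q (q * x r / x t) (m r))
      = ∏ t, if t = s then 1 else qPoch q (x r / qNode q x k t) (m r)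
        / qPoch q (q * x r / x t) (m r) := by
    refine Finset.prod_congr rfl fun t _ => ?_
    by_cases ht : t = s
    · simp [ht]
    · simp only [if_neg ht, qNode_add_single]
  have h2 : qPoch q (x r / qNode q x k s) (m r) * (1 - x r / (q * qNode q x k s))
      = qPoch q (x r / (q * qNode q x k s)) (m r)
        * (1 - qNode q x m r / (q * qNode q x k s)) := by
    have e := qPoch_succ' q (x r / (q * qNode q x k s)) (m r)
    rw [qPoch_succ] at e
    have e2 : x r / (q * qNode q x k s) * q = x r / qNode q x k s := by
      have := hx.q_ne
      have := hx.qNode_ne k s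
      field_simp
    rw [e2] at e
    rw [mul_comm, ← e, div_mul_eq_mul_div]
    rfl
  rw [h1, qNode_add_single, if_pos rfl]
  linear_combination ((∏ t, if t = s then 1 else qPoch q (x r / qNode q x k t) (m r)
        / qPoch q (q * x r / x t) (m r)) / qPoch q (q * x r / x s) (m r)) * h2

/-- The same transfer argument, now with the weight for `k + e_s`. The weight for `k` differs from
it by the factor `∏ (1 - κ y_t)`, up to the constant `C`, where `κ = 1/(qη)`; hence both weights
appear in one relation. The upper level uses `ε = c η`, so that `ε κ = c / q`. -/
theorem dualLevel_succ {n : ℕ} {q a c : ℂ} {x : Fin n → ℂ} (hx : QGeneric q x)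
    (hc : ∀ r j, qPoch q (c * x r) j ≠ 0) (k : Fin n → ℕ) (s : Fin n) (L : ℕ) :
    (1 - c * qNode q x k s) * q ^ (L + 1) * dualLevel q a c x (k + Pi.single s 1) (L + 1)
      = (1 - c * qNode q x k s * q ^ (L + 1)) * dualLevel q a c x k (L + 1)
        - (1 - a * qNode q x k s * q ^ L / q ^ (∑ t, k t)) * dualLevel q a c x k L := by
  set η := qNode q x k s with hη
  have hη0 : η ≠ 0 := hx.qNode_ne k s
  have hq0 := hx.q_ne
  set κ := (q * η)⁻¹ with hκ
  set H : (Fin n → ℕ) → ℂ := fun m =>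
    ∏ r, qPoch q (a * x r) (m r) / qPoch q (c * x r) (m r) with hH
  set N : (Fin n → ℕ) → ℂ := anWeight q x (qNode q x (k + Pi.single s 1)) with hN
  set C : ℂ := ∏ r, (1 - x r / (q * η)) with hC
  have hC0 : C ≠ 0 := by
    refine Finset.prod_ne_zero_iff.2 fun r _ => ?_
    have := (hx.shift (k + Pi.single s 1)).x_ne s
    rw [qNode_add_single, if_pos rfl] at this
    rw [one_sub_div this]
    refine div_ne_zero ?_ this
    rw [qNode]
    by_cases hrs : s = r
    · subst hrs
      intro h0
      refine hx.pow_ne (k s) (mul_left_cancel₀ (hx.x_ne s) ?_)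
      rw [pow_succ]
      linear_combination h0
    · intro h0
      refine hx.inj s r hrs (k s + 1) 0 ?_
      rw [pow_succ]
      linear_combination h0
  have hcg : ∀ m, anWeight q x (qNode q x k) m * C = N m * ∏ t, (1 - κ * qNode q x m t) := by
    intro m
    rw [hC, hN, anWeight_qNode_add_single hx]
    congr 1
    refine Finset.prod_congr rfl fun t _ => ?_
    rw [hκ, div_eq_inv_mul]
  -- The factor of `w = x q^(k + e_s)` at `s` is `1 - κ y_r`, which the product `∏ (1 - κ y_t)`
  -- already supplies. The vacated slot takes the factor `1 - a y_r` coming from `(a x_r)_(m_r)`.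
  let p : Fin n → ℂ := fun t => if t = s then a else (qNode q x k t)⁻¹
  have key := sum_piAntidiag_single_shift L
    (fun m r => N m * H m * (∏ t, (1 - κ * qNode q x m t)) * (∏ t, (1 - p t * qNode q x m r))
      * lagCoeff (qNode q x m) r)
    (fun m r => N m * H m * (∏ t, (1 - qNode q x m r / x t)) * (1 - c / q * qNode q x m r)
      * (∏ t, if t = r then 1 else (1 - κ * qNode q x m t)) * lagCoeff (qNode q x m) r)
    (fun m r => by
      have h1 := anWeight_transfer hx (qNode q x (k + Pi.single s 1)) m r
      have h2 : (∏ t, if t = r then 1 else (1 - κ * qNode q x (m + Pi.single r 1) t))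
          = ∏ t, if t = r then 1 else (1 - κ * qNode q x m t) := by
        refine Finset.prod_congr rfl fun t _ => ?_
        by_cases ht : t = r
        · simp [ht]
        · simp only [if_neg ht, qNode_add_single]
      have h3 := prod_eq_mul_prod_ite (fun t => 1 - κ * qNode q x m t) r
      have h4 : (1 - κ * qNode q x m r) * ∏ t, (1 - p t * qNode q x m r)
          = (1 - a * qNode q x m r)
            * ∏ t, (1 - qNode q x m r / qNode q x (k + Pi.single s 1) t) := by
        have e0 := prod_eq_mul_prod_ite
          (fun t => 1 - qNode q x m r / qNode q x (k + Pi.single s 1) t) s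
        have e1 := prod_eq_mul_prod_ite (fun t => 1 - p t * qNode q x m r) s
        simp only [e0, e1]
        have e : (∏ t, if t = s then 1 else (1 - p t * qNode q x m r))
            = ∏ t, if t = s then 1
              else (1 - qNode q x m r / qNode q x (k + Pi.single s 1) t) := by
          refine Finset.prod_congr rfl fun t _ => ?_
          by_cases ht : t = s
          · simp [ht]
          · simp only [if_neg ht, qNode_add_single, p, div_eq_inv_mul]
        rw [e, qNode_add_single, if_pos rfl, hκ, div_eq_inv_mul]
        simp only [p, if_true]
        ring
      have h5 : H (m + Pi.single r 1) * (1 - c * qNode q x m r)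
          = H m * (1 - a * qNode q x m r) := by
        have hne : 1 - c * x r * q ^ m r ≠ 0 := by
          have := hc r (m r + 1)
          rw [qPoch_succ] at this
          exact right_ne_zero_of_mul this
        have := prod_apply_add_single
          (fun i j => qPoch q (a * x i) j / qPoch q (c * x i) j)
          (fun i => (1 - a * qNode q x m i) / (1 - c * qNode q x m i)) m r (by
            simp only [qPoch_succ, qNode, ← mul_assoc]
            rw [mul_div_mul_comm])
        simp only [hH]
        rw [this, mul_assoc, div_mul_cancel₀]
        rwa [qNode, ← mul_assoc]
      have h6 : c / q * qNode q x (m + Pi.single r 1) r = c * qNode q x m r := by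
        rw [qNode_add_single, if_pos rfl]
        field_simp
      simp only [h2, h3, h6]
      linear_combination H m * (1 - a * qNode q x m r)
          * (∏ t, if t = r then 1 else (1 - κ * qNode q x m t)) * h1
        + N m * H m * (∏ t, if t = r then 1 else (1 - κ * qNode q x m t))
          * lagCoeff (qNode q x m) r * h4
        - N (m + Pi.single r 1) * (∏ t, (1 - qNode q x (m + Pi.single r 1) r / x t))
          * (∏ t, if t = r then 1 else (1 - κ * qNode q x m t))
          * lagCoeff (qNode q x (m + Pi.single r 1)) r * h5)
    (fun m r h => by simp only [prod_one_sub_eq_zero hx m r h]; ring)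
  have hL : ∀ m : Fin n → ℕ, ∑ r, N m * H m * (∏ t, (1 - κ * qNode q x m t))
      * (∏ t, (1 - p t * qNode q x m r)) * lagCoeff (qNode q x m) r
      = anWeight q x (qNode q x k) m * C * H m
        * (1 - a * η * q ^ (∑ t, m t) / q ^ (∑ t, k t)) := by
    intro m
    have h1 := sum_lagCoeff (qNode q x m) p (hx.qNode_injective m) (hx.qNode_ne m)
    have h2 : ∏ t, p t * qNode q x m t = a * η * q ^ (∑ t, m t) / q ^ (∑ t, k t) := by
      have e : ∀ t, p t * qNode q x m t
          = (if t = s then a * η else 1) * ((q ^ k t)⁻¹ * ((x t)⁻¹ * qNode q x m t)) := by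
        intro t
        have hxt := hx.x_ne t
        have hqt := pow_ne_zero (k t) hq0
        by_cases ht : t = s
        · subst ht
          simp only [p, if_true, hη, qNode]
          field_simp
        · simp only [p, if_neg ht, qNode]
          field_simp
      simp only [e]
      rw [Finset.prod_mul_distrib, Finset.prod_mul_distrib, prod_qNode_div hx,
        Finset.prod_ite_eq' Finset.univ s, if_pos (Finset.mem_univ s), Finset.prod_inv_distrib,
        Finset.prod_pow_eq_pow_sum]
      field_simp
    rw [h2] at h1
    rw [← h1, hcg, Finset.mul_sum]
    exact Finset.sum_congr rfl fun r _ => by ring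
  have hR : ∀ m : Fin n → ℕ, ∑ r, N m * H m * (∏ t, (1 - qNode q x m r / x t))
      * (1 - c / q * qNode q x m r)
      * (∏ t, if t = r then 1 else (1 - κ * qNode q x m t)) * lagCoeff (qNode q x m) r
      = C * ((1 - c * η * q ^ (∑ t, m t)) * (anWeight q x (qNode q x k) m * H m)
        - (1 - c * η) * q ^ (∑ t, m t) * (N m * H m)) := by
    intro m
    have h1 := sum_lagCoeff_mul_prod (qNode q x m) (fun t => (x t)⁻¹) (hx.qNode_injective m)
      (hx.qNode_ne m) (c * η) κ
    rw [prod_inv_sub_mul_qNode hx x hx.x_ne, prod_qNode_div hx] at h1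
    have h2 : c * η * κ = c / q := by
      rw [hκ]
      field_simp
    have h3 : ∏ t, x t / x t = 1 := Finset.prod_eq_one fun t _ => div_self (hx.x_ne t)
    have h4 : ∏ t, (1 - κ * x t) = C := by
      refine Finset.prod_congr rfl fun t _ => ?_
      rw [hκ, div_eq_inv_mul]
    rw [h2, h3, h4, one_mul] at h1
    have h5 := hcg m
    calc _ = N m * H m * ∑ r, (∏ t, (1 - (x t)⁻¹ * qNode q x m r))
          * (1 - c / q * qNode q x m r)
          * (∏ t, if t = r then 1 else (1 - κ * qNode q x m t)) * lagCoeff (qNode q x m) r := by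
            rw [Finset.mul_sum]
            refine Finset.sum_congr rfl fun r _ => ?_
            simp only [div_eq_inv_mul]
            ring
      _ = _ := by
        rw [h1]
        linear_combination -(H m * (1 - c * η * q ^ (∑ t, m t))) * h5
  simp only [hL, hR] at key
  have e1 : ∑ m ∈ Finset.piAntidiag Finset.univ L, anWeight q x (qNode q x k) m * C * H m
        * (1 - a * η * q ^ (∑ t, m t) / q ^ (∑ t, k t))
      = C * ((1 - a * η * q ^ L / q ^ (∑ t, k t)) * dualLevel q a c x k L) := by
    rw [dualLevel, Finset.mul_sum, Finset.mul_sum]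
    refine Finset.sum_congr rfl fun m hm => ?_
    rw [(Finset.mem_piAntidiag.1 hm).1]
    ring
  have e2 : ∑ m ∈ Finset.piAntidiag Finset.univ (L + 1),
      C * ((1 - c * η * q ^ (∑ t, m t)) * (anWeight q x (qNode q x k) m * H m)
        - (1 - c * η) * q ^ (∑ t, m t) * (N m * H m))
      = C * ((1 - c * η * q ^ (L + 1)) * dualLevel q a c x k (L + 1)
        - (1 - c * η) * q ^ (L + 1) * dualLevel q a c x (k + Pi.single s 1) (L + 1)) := by
    rw [← Finset.mul_sum, Finset.sum_sub_distrib, dualLevel, dualLevel]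
    congr 2
    · rw [Finset.mul_sum]
      refine Finset.sum_congr rfl fun m hm => ?_
      rw [(Finset.mem_piAntidiag.1 hm).1]
    · rw [Finset.mul_sum]
      refine Finset.sum_congr rfl fun m hm => ?_
      rw [(Finset.mem_piAntidiag.1 hm).1]
  rw [e1, e2] at key
  have := mul_left_cancel₀ hC0 key
  linear_combination this

/-! ### Infinite products and uniform bounds for `q`-shifted factorials. -/

theorem summable_norm_mul_pow {q : ℂ} (hq : ‖q‖ < 1) (z : ℂ) :
    Summable fun i : ℕ => ‖-(z * q ^ i)‖ := by
  simp only [norm_neg, norm_mul, norm_pow]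
  exact (summable_geometric_of_lt_one (norm_nonneg q) hq).mul_left _

theorem tendsto_qPoch {q : ℂ} (hq : ‖q‖ < 1) (z : ℂ) :
    Filter.Tendsto (qPoch q z) Filter.atTop (nhds (qPochInf q z)) := by
  have h := (multipliable_one_add_of_summable (summable_norm_mul_pow hq z)).hasProd
  have h2 := h.tendsto_prod_nat
  simp only [← sub_eq_add_neg] at h2
  exact h2

theorem qPochInf_eq_mul {q : ℂ} (hq : ‖q‖ < 1) (z : ℂ) (k : ℕ) :
    qPochInf q z = qPoch q z k * qPochInf q (z * q ^ k) := by
  have h1 := (tendsto_qPoch hq z).comp (Filter.tendsto_add_atTop_nat k)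
  have h2 := (tendsto_qPoch hq (z * q ^ k)).const_mul (qPoch q z k)
  refine tendsto_nhds_unique h1 (h2.congr fun l => ?_)
  rw [Function.comp_apply, add_comm, qPoch_add]

theorem qPoch_ne_zero_of_qPochInf {q z : ℂ} (hq : ‖q‖ < 1) (h : qPochInf q z ≠ 0) (k : ℕ) :
    qPoch q z k ≠ 0 := by
  rw [qPochInf_eq_mul hq z k] at h
  exact left_ne_zero_of_mul h

theorem qPochInf_ne_zero {q z : ℂ} (hq : ‖q‖ < 1) (h : ∀ i : ℕ, 1 - z * q ^ i ≠ 0) :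
    qPochInf q z ≠ 0 := by
  have := tprod_one_add_ne_zero_of_summable (f := fun i : ℕ => -(z * q ^ i))
    (fun i => by rw [← sub_eq_add_neg]; exact h i) (summable_norm_mul_pow hq z)
  simp only [← sub_eq_add_neg] at this
  exact this

/-- Since `R ≥ 1`, each factor satisfies `R + t ≤ R (1 + t) ≤ R exp t`, and the exponents sum to at
most a geometric series. -/
theorem norm_prod_add_pow_le {p : ℝ} (hp0 : 0 ≤ p) (hp : p < 1) {R y : ℝ} (hR : 1 ≤ R)
    (hy : 0 ≤ y) (k : ℕ) :
    ∏ i ∈ Finset.range k, (R + y * p ^ i) ≤ R ^ k * Real.exp (y / (1 - p)) := by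
  have h1 : ∏ i ∈ Finset.range k, (R + y * p ^ i)
      ≤ ∏ i ∈ Finset.range k, (R * Real.exp (y * p ^ i)) := by
    refine Finset.prod_le_prod (fun i _ => by positivity) fun i _ => ?_
    have h2 := Real.add_one_le_exp (y * p ^ i)
    have h3 : 0 ≤ y * p ^ i := by positivity
    nlinarith
  refine h1.trans ?_
  rw [Finset.prod_mul_distrib, Finset.prod_const, Finset.card_range, ← Real.exp_sum]
  refine mul_le_mul_of_nonneg_left (Real.exp_le_exp.2 ?_) (by positivity)
  rw [← Finset.mul_sum, div_eq_mul_inv, ← tsum_geometric_of_lt_one hp0 hp]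
  exact mul_le_mul_of_nonneg_left
    ((summable_geometric_of_lt_one hp0 hp).sum_le_tsum _ fun i _ => by positivity) hy

theorem norm_qPoch_le {q : ℂ} (hq : ‖q‖ < 1) (z : ℂ) (k : ℕ) :
    ‖qPoch q z k‖ ≤ Real.exp (‖z‖ / (1 - ‖q‖)) := by
  have h := norm_prod_add_pow_le (norm_nonneg q) hq le_rfl (norm_nonneg z) k
  rw [one_pow, one_mul] at h
  refine le_trans ?_ h
  rw [qPoch, norm_prod]
  refine Finset.prod_le_prod (fun i _ => norm_nonneg _) fun i _ => ?_
  refine (norm_sub_le _ _).trans ?_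
  rw [norm_one, norm_mul, norm_pow]

theorem norm_qPochInf_le {q : ℂ} (hq : ‖q‖ < 1) (z : ℂ) :
    ‖qPochInf q z‖ ≤ Real.exp (‖z‖ / (1 - ‖q‖)) :=
  le_of_tendsto (tendsto_qPoch hq z).norm (Filter.Eventually.of_forall (norm_qPoch_le hq z))

/-- The reciprocals converge to a finite limit, hence are bounded. -/
theorem exists_le_norm_qPoch {q z : ℂ} (hq : ‖q‖ < 1) (h : qPochInf q z ≠ 0) :
    ∃ δ : ℝ, 0 < δ ∧ ∀ k, δ ≤ ‖qPoch q z k‖ := by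
  have h1 : Filter.Tendsto (fun k => ‖(qPoch q z k)⁻¹‖) Filter.atTop
      (nhds ‖(qPochInf q z)⁻¹‖) := ((tendsto_qPoch hq z).inv₀ h).norm
  obtain ⟨B, hB⟩ := h1.bddAbove_range
  refine ⟨(max B 1)⁻¹, by positivity, fun k => ?_⟩
  have h2 : ‖(qPoch q z k)⁻¹‖ ≤ max B 1 := (hB ⟨k, rfl⟩).trans (le_max_left _ _)
  rw [norm_inv] at h2
  exact inv_le_of_inv_le₀ (norm_pos_iff.2 (qPoch_ne_zero_of_qPochInf hq h k)) h2

/-! ### Growth of iterated `q`-differences. -/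

/-- The `q`-difference operator `F ↦ (F(L) - F(L + 1)) / q^L` on sequences. -/
noncomputable def qDiff (q : ℂ) (F : ℕ → ℂ) (L : ℕ) : ℂ := (F L - F (L + 1)) / q ^ L

/-- All iterated `q`-differences of `F` are bounded by `B R^j`. -/
def QDiffBound (q : ℂ) (R B : ℝ) (F : ℕ → ℂ) : Prop :=
  ∀ j L, ‖((qDiff q)^[j] F) L‖ ≤ B * R ^ j

theorem qDiff_iterate_add (q : ℂ) (F G : ℕ → ℂ) (j L : ℕ) :
    ((qDiff q)^[j] fun L => F L + G L) L = ((qDiff q)^[j] F) L + ((qDiff q)^[j] G) L := by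
  induction j generalizing F G with
  | zero => rfl
  | succ j ih =>
    have e : (qDiff q fun L => F L + G L) = fun L => qDiff q F L + qDiff q G L := by
      funext L
      simp only [qDiff]
      ring
    rw [Function.iterate_succ_apply, Function.iterate_succ_apply, Function.iterate_succ_apply,
      e, ih]

theorem qDiff_iterate_const_mul (q : ℂ) (F : ℕ → ℂ) (u : ℂ) (j L : ℕ) :
    ((qDiff q)^[j] fun L => u * F L) L = u * ((qDiff q)^[j] F) L := by
  induction j generalizing F with
  | zero => rfl
  | succ j ih =>
    have e : (qDiff q fun L => u * F L) = fun L => u * qDiff q F L := by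
      funext L
      simp only [qDiff]
      ring
    rw [Function.iterate_succ_apply, Function.iterate_succ_apply, e, ih]

theorem qDiff_iterate_shift {q : ℂ} (hq : q ≠ 0) (F : ℕ → ℂ) (j L : ℕ) :
    ((qDiff q)^[j] fun L => F (L + 1)) L = q ^ j * ((qDiff q)^[j] F) (L + 1) := by
  induction j generalizing F with
  | zero => simp
  | succ j ih =>
    have h : (qDiff q fun L => F (L + 1)) = fun L => q * (qDiff q F) (L + 1) := by
      funext L
      simp only [qDiff]
      field_simp
      ring
    rw [Function.iterate_succ_apply, Function.iterate_succ_apply, h,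
      qDiff_iterate_const_mul, ih]
    ring

namespace QDiffBound

variable {q : ℂ} {R B B' : ℝ} {F G : ℕ → ℂ}

theorem qDiff (h : QDiffBound q R B F) : QDiffBound q R (B * R) (qDiff q F) := fun j L => by
  have := h (j + 1) L
  rw [Function.iterate_succ_apply] at this
  rwa [mul_assoc, ← pow_succ']

theorem add (h : QDiffBound q R B F) (h' : QDiffBound q R B' G) :
    QDiffBound q R (B + B') fun L => F L + G L := fun j L => by
  rw [qDiff_iterate_add, add_mul]
  exact (norm_add_le _ _).trans (add_le_add (h j L) (h' j L))

theorem const_mul (h : QDiffBound q R B F) (u : ℂ) :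
    QDiffBound q R (‖u‖ * B) fun L => u * F L := fun j L => by
  rw [qDiff_iterate_const_mul, norm_mul, mul_assoc]
  exact mul_le_mul_of_nonneg_left (h j L) (norm_nonneg u)

theorem shift (h : QDiffBound q R B F) (hq0 : q ≠ 0) (hq : ‖q‖ < 1) :
    QDiffBound q R B fun L => F (L + 1) := fun j L => by
  rw [qDiff_iterate_shift hq0, norm_mul, norm_pow]
  refine le_trans ?_ (h j (L + 1))
  exact mul_le_of_le_one_left (norm_nonneg _) (pow_le_one₀ (norm_nonneg q) hq.le)

end QDiffBound

/-! ### Bounds for the inner series. -/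

theorem anWeight_qNode_eq_zero {n : ℕ} {q : ℂ} {x : Fin n → ℂ} (hx : QGeneric q x)
    (k m : Fin n → ℕ) (h : ¬ m ≤ k) : anWeight q x (qNode q x k) m = 0 := by
  rw [Pi.le_def, not_forall] at h
  obtain ⟨r, hr⟩ := h
  refine mul_eq_zero_of_right _ (Finset.prod_eq_zero (Finset.mem_univ r)
    (Finset.prod_eq_zero (Finset.mem_univ r) ?_))
  have : qPoch q (x r / qNode q x k r) (m r) = 0 := by
    refine Finset.prod_eq_zero (Finset.mem_range.2 (not_le.1 hr)) ?_
    have h1 := hx.x_ne r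
    have h2 := pow_ne_zero (k r) hx.q_ne
    rw [qNode]
    field_simp
    ring
  rw [this, zero_div]

theorem dualLevel_eq_zero {n : ℕ} {q : ℂ} {x : Fin n → ℂ} (hx : QGeneric q x) (a c : ℂ)
    (k : Fin n → ℕ) (L : ℕ) (h : ∑ t, k t < L) : dualLevel q a c x k L = 0 := by
  refine Finset.sum_eq_zero fun m hm => ?_
  rw [anWeight_qNode_eq_zero hx k m, zero_mul]
  intro hmk
  have h1 := (Finset.mem_piAntidiag.1 hm).1
  have h2 : ∑ t, m t ≤ ∑ t, k t := Finset.sum_le_sum fun t _ => hmk t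
  exact absurd h (not_lt.2 (h1 ▸ h2))

/-- The inner series with a general sequence `F(|m|)` of coefficients. -/
noncomputable def dualSum {n : ℕ} (q a c : ℂ) (x : Fin n → ℂ) (k : Fin n → ℕ) (F : ℕ → ℂ) : ℂ :=
  ∑ L ∈ Finset.range (∑ t, k t + 1), dualLevel q a c x k L * (q ^ L * F L)

theorem dualSum_zero {n : ℕ} {q : ℂ} {x : Fin n → ℂ} (hx : QGeneric q x) (a c : ℂ)
    (F : ℕ → ℂ) : dualSum q a c x 0 F = F 0 := by
  simp [dualSum, dualLevel, anWeight_zero hx, qPoch_zero]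

/-- Summation by parts in `dualLevel_succ`: the recurrence for the level sums becomes an operator
acting on `F`. -/
theorem dualSum_add_single {n : ℕ} {q a c : ℂ} {x : Fin n → ℂ} (hx : QGeneric q x)
    (hc : ∀ r j, qPoch q (c * x r) j ≠ 0) (k : Fin n → ℕ) (s : Fin n) (F : ℕ → ℂ) :
    (1 - c * qNode q x k s) * dualSum q a c x (k + Pi.single s 1) F
      = dualSum q a c x k fun L => qDiff q F L + (-(c * qNode q x k s)) * F L
          + (a * qNode q x k s / q ^ (∑ t, k t)) * F (L + 1) := by
  have hs : ∑ t, (k + Pi.single s 1 : Fin n → ℕ) t = ∑ t, k t + 1 := by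
    simp [Finset.sum_add_distrib]
  set K := ∑ t, k t with hK
  set η := qNode q x k s
  have h0 : ∀ k, dualLevel q a c x k 0 = 1 := fun k => by
    simp [dualLevel, anWeight_zero hx, qPoch_zero]
  rw [dualSum, hs, Finset.sum_range_succ', h0, mul_add, Finset.mul_sum]
  have h1 : ∀ L, (1 - c * η) * (dualLevel q a c x (k + Pi.single s 1) (L + 1)
      * (q ^ (L + 1) * F (L + 1)))
      = (1 - c * η * q ^ (L + 1)) * dualLevel q a c x k (L + 1) * F (L + 1)
        - (1 - a * η * q ^ L / q ^ K) * dualLevel q a c x k L * F (L + 1) := fun L => by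
    linear_combination F (L + 1) * dualLevel_succ (a := a) hx hc k s L
  simp only [h1]
  rw [Finset.sum_sub_distrib]
  have h2 : ∑ L ∈ Finset.range (K + 1),
      (1 - c * η * q ^ (L + 1)) * dualLevel q a c x k (L + 1) * F (L + 1)
      + (1 - c * η) * (1 * (q ^ 0 * F 0))
      = ∑ L ∈ Finset.range (K + 1), (1 - c * η * q ^ L) * dualLevel q a c x k L * F L := by
    have h3 := Finset.sum_range_succ'
      (fun L => (1 - c * η * q ^ L) * dualLevel q a c x k L * F L) (K + 1)
    rw [Finset.sum_range_succ, dualLevel_eq_zero hx a c k (K + 1) (by omega), h0] at h3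
    rw [mul_zero, zero_mul, add_zero] at h3
    rw [h3, pow_zero]
    ring
  rw [sub_add_eq_add_sub, h2, ← Finset.sum_sub_distrib, dualSum]
  refine Finset.sum_congr rfl fun L _ => ?_
  have hL := pow_ne_zero L hx.q_ne
  have hK := pow_ne_zero K hx.q_ne
  simp only [qDiff]
  field_simp
  ring

/-- The outer index is lowered one unit at a time by `dualSum_add_single`. Each unit costs a factor
`R` from the `q`-difference plus a perturbation that decays geometrically in `k_s`. -/
theorem norm_dualSum_mul_le {n : ℕ} {q a c : ℂ} {x : Fin n → ℂ} (hx : QGeneric q x)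
    (hq : ‖q‖ < 1) (hc : ∀ r j, qPoch q (c * x r) j ≠ 0) {R D : ℝ} (hR : 0 ≤ R)
    (N : ℕ) (hD : ‖c‖ + ‖a‖ / ‖q‖ ^ N ≤ D) (k : Fin n → ℕ) (hk : ∑ t, k t = N)
    (F : ℕ → ℂ) (B : ℝ) (hF : QDiffBound q R B F) :
    ‖dualSum q a c x k F‖ * ‖∏ r, qPoch q (c * x r) (k r)‖
      ≤ B * ∏ r, ∏ i ∈ Finset.range (k r), (R + ‖x r‖ * D * ‖q‖ ^ i) := by
  have hD0 : 0 ≤ D := le_trans (by positivity) hD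
  induction N generalizing k F B with
  | zero =>
    have hk0 : k = 0 := by
      funext t
      exact (Finset.sum_eq_zero_iff.1 hk) t (Finset.mem_univ t)
    subst hk0
    have := hF 0 0
    simpa [dualSum_zero hx, qPoch_zero] using this
  | succ N ih =>
    obtain ⟨s, hs⟩ : ∃ s, k s ≠ 0 := by
      by_contra! h
      simp [h] at hk
    obtain ⟨k', rfl⟩ : ∃ k' : Fin n → ℕ, k = k' + Pi.single s 1 := by
      refine ⟨k - Pi.single s 1, ?_⟩
      funext i
      by_cases hi : i = s
      · subst hi
        simp only [Pi.add_apply, Pi.sub_apply, Pi.single_eq_same]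
        omega
      · simp [hi]
    have hk' : ∑ t, k' t = N := by
      simp only [Pi.add_apply, Finset.sum_add_distrib] at hk
      simpa using hk
    have hq0 : 0 < ‖q‖ := norm_pos_iff.2 hx.q_ne
    -- The parameter `a` stays fixed while `|k|` decreases, so the coefficient `a / q^|k|` is
    -- largest in norm at the top and one `D` serves every step.
    have hle : ‖a‖ / ‖q‖ ^ N ≤ ‖a‖ / ‖q‖ ^ (N + 1) := by
      refine div_le_div_of_nonneg_left (norm_nonneg a) (by positivity) ?_
      rw [pow_succ]
      exact mul_le_of_le_one_right (by positivity) hq.le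
    have hD' : ‖c‖ + ‖a‖ / ‖q‖ ^ N ≤ D := by linarith
    have hF' := (hF.qDiff.add (hF.const_mul (-(c * qNode q x k' s)))).add
      ((hF.shift hx.q_ne hq).const_mul (a * qNode q x k' s / q ^ (∑ t, k' t)))
    have h := ih hD' k' hk' _ _ hF'
    rw [← dualSum_add_single hx hc k' s F] at h
    have e1 := prod_apply_add_single (fun r j => qPoch q (c * x r) j)
      (fun r => 1 - c * qNode q x k' r) k' s (by
        rw [qPoch_succ, qNode, mul_assoc c])
    have e2 := prod_apply_add_single
      (fun r j => ∏ i ∈ Finset.range j, (R + ‖x r‖ * D * ‖q‖ ^ i))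
      (fun r => R + ‖x r‖ * D * ‖q‖ ^ k' r) k' s (by rw [Finset.prod_range_succ])
    rw [e1, e2]
    have hB : 0 ≤ B := by
      have := (norm_nonneg _).trans (hF 0 0)
      simpa using this
    set Pr := ∏ r, ∏ i ∈ Finset.range (k' r), (R + ‖x r‖ * D * ‖q‖ ^ i) with hPr
    have hPr0 : 0 ≤ Pr := by positivity
    rw [norm_mul] at h ⊢
    calc _ = ‖1 - c * qNode q x k' s‖ * ‖dualSum q a c x (k' + Pi.single s 1) F‖
          * ‖∏ r, qPoch q (c * x r) (k' r)‖ := by ring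
      _ ≤ _ := h
      _ ≤ B * (R + ‖x s‖ * D * ‖q‖ ^ k' s) * Pr := by
        refine mul_le_mul_of_nonneg_right ?_ hPr0
        rw [hk', norm_neg, norm_mul, norm_div, norm_mul, norm_pow, qNode, norm_mul, norm_pow]
        have e3 : ‖a‖ * (‖x s‖ * ‖q‖ ^ k' s) / ‖q‖ ^ N
            = (‖a‖ / ‖q‖ ^ N) * (‖x s‖ * ‖q‖ ^ k' s) := by ring
        have e4 : (‖c‖ + ‖a‖ / ‖q‖ ^ N) * (‖x s‖ * ‖q‖ ^ k' s) ≤ D * (‖x s‖ * ‖q‖ ^ k' s) :=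
          mul_le_mul_of_nonneg_right hD' (by positivity)
        rw [e3]
        nlinarith [mul_le_mul_of_nonneg_left e4 hB]
      _ = _ := by ring

/-- For `a = α q^|k|` the constant `D = ‖c‖ + ‖α‖` is independent of `k`, and the perturbed products
exceed `R^|k|` only by a bounded factor. -/
theorem exists_norm_dualSum_le {n : ℕ} {q α c : ℂ} {x : Fin n → ℂ} (hx : QGeneric q x)
    (hq : ‖q‖ < 1) (hc : ∀ r, qPochInf q (c * x r) ≠ 0) {R B : ℝ} (hR : 1 ≤ R)
    (F : ℕ → ℂ) (hF : QDiffBound q R B F) :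
    ∃ C : ℝ, 0 ≤ C ∧ ∀ k : Fin n → ℕ,
      ‖dualSum q (α * q ^ (∑ t, k t)) c x k F‖ ≤ C * R ^ (∑ t, k t) := by
  choose δ hδ0 hδ using fun r => exists_le_norm_qPoch hq (hc r)
  have hq0 : 0 < ‖q‖ := norm_pos_iff.2 hx.q_ne
  have hB : 0 ≤ B := by
    have := (norm_nonneg _).trans (hF 0 0)
    simpa using this
  set D := ‖c‖ + ‖α‖ with hDdef
  have hD0 : 0 ≤ D := by positivity
  refine ⟨B * ∏ r, (Real.exp (‖x r‖ * D / (1 - ‖q‖)) / δ r), mul_nonneg hB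
    (Finset.prod_nonneg fun r _ => div_nonneg (Real.exp_pos _).le (hδ0 r).le), fun k => ?_⟩
  have h := norm_dualSum_mul_le (a := α * q ^ (∑ t, k t)) (D := D) hx hq
    (fun r => qPoch_ne_zero_of_qPochInf hq (hc r)) (zero_le_one.trans hR) (∑ t, k t) (by
      rw [norm_mul, norm_pow, mul_div_cancel_right₀ _ (by positivity)]) k rfl F B hF
  have hδp : 0 < ∏ r, δ r := Finset.prod_pos fun r _ => hδ0 r
  have h1 : ∏ r, δ r ≤ ‖∏ r, qPoch q (c * x r) (k r)‖ := by
    rw [norm_prod]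
    exact Finset.prod_le_prod (fun r _ => (hδ0 r).le) fun r _ => hδ r _
  have h2 : ∏ r, ∏ i ∈ Finset.range (k r), (R + ‖x r‖ * D * ‖q‖ ^ i)
      ≤ ∏ r, (R ^ k r * Real.exp (‖x r‖ * D / (1 - ‖q‖))) :=
    Finset.prod_le_prod (fun r _ => Finset.prod_nonneg fun i _ => by positivity) fun r _ =>
      norm_prod_add_pow_le (norm_nonneg q) hq hR (by positivity) _
  rw [Finset.prod_mul_distrib, Finset.prod_pow_eq_pow_sum] at h2
  rw [Finset.prod_div_distrib, mul_div_assoc', div_mul_eq_mul_div, le_div_iff₀ hδp]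
  calc _ ≤ ‖dualSum q (α * q ^ (∑ t, k t)) c x k F‖ * ‖∏ r, qPoch q (c * x r) (k r)‖ :=
        mul_le_mul_of_nonneg_left h1 (norm_nonneg _)
    _ ≤ _ := h.trans (mul_le_mul_of_nonneg_left h2 hB)
    _ = _ := by ring

/-! ### `q`-differences of the coefficient sequence. -/

theorem qDiff_iterate_qPoch_div {q β c : ℂ} (hq0 : q ≠ 0) (hc : ∀ j, qPoch q c j ≠ 0) (j L : ℕ) :
    ((qDiff q)^[j] fun L => qPoch q β L / qPoch q c L) L
      = (∏ i ∈ Finset.range j, (β - c * q ^ i)) * (qPoch q β L / qPoch q c (j + L)) := by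
  induction j generalizing L with
  | zero => simp
  | succ j ih =>
    rw [Function.iterate_succ_apply', qDiff, ih, ih, Finset.prod_range_succ,
      show j + (L + 1) = j + L + 1 by ring, show j + 1 + L = j + L + 1 by ring,
      qPoch_succ q β, qPoch_succ q c]
    have h1 := hc (j + L)
    have h2 := hc (j + L + 1)
    rw [qPoch_succ] at h2
    have h3 := right_ne_zero_of_mul h2
    have h4 := pow_ne_zero L hq0
    rw [div_eq_iff h4]
    field_simp
    ring

theorem exists_qDiffBound_qPoch_div {q β c : ℂ} (hq0 : q ≠ 0) (hq : ‖q‖ < 1)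
    (hc : qPochInf q c ≠ 0) {R : ℝ} (hR : 1 ≤ R) (hβ : ‖β‖ ≤ R) :
    ∃ B : ℝ, 0 ≤ B ∧ QDiffBound q R B fun L => qPoch q β L / qPoch q c L := by
  obtain ⟨δ, hδ0, hδ⟩ := exists_le_norm_qPoch hq hc
  refine ⟨Real.exp (‖c‖ / (1 - ‖q‖)) * (Real.exp (‖β‖ / (1 - ‖q‖)) / δ), by positivity,
    fun j L => ?_⟩
  rw [qDiff_iterate_qPoch_div hq0 (qPoch_ne_zero_of_qPochInf hq hc), norm_mul, norm_div, norm_prod]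
  have h1 : ∏ i ∈ Finset.range j, ‖β - c * q ^ i‖ ≤ R ^ j * Real.exp (‖c‖ / (1 - ‖q‖)) := by
    refine le_trans ?_ (norm_prod_add_pow_le (norm_nonneg q) hq hR (norm_nonneg c) j)
    refine Finset.prod_le_prod (fun i _ => norm_nonneg _) fun i _ => ?_
    refine (norm_sub_le _ _).trans ?_
    rw [norm_mul, norm_pow]
    linarith
  have h2 : ‖qPoch q β L‖ / ‖qPoch q c (j + L)‖ ≤ Real.exp (‖β‖ / (1 - ‖q‖)) / δ :=
    div_le_div₀ (Real.exp_pos _).le (norm_qPoch_le hq β L) hδ0 (hδ _)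
  calc _ ≤ (R ^ j * Real.exp (‖c‖ / (1 - ‖q‖))) * (Real.exp (‖β‖ / (1 - ‖q‖)) / δ) :=
        mul_le_mul h1 h2 (by positivity) (by positivity)
    _ = _ := by ring

/-- The twisted Leibniz rule sends a product to `q^i` times a term differentiating `G`, plus a term
differentiating `F` and raising `i`. As `q^i` decays, the first branch is eventually negligible, so
the rate is `(1 + ε) R` instead of the `2 R` of an untwisted rule. The weights `K i` record how far
`i` has advanced. -/
theorem norm_qDiff_iterate_mul_le {q : ℂ} (hq0 : q ≠ 0) {R B B' ε : ℝ} (hR : 0 ≤ R)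
    (hε : 0 < ε) {F G : ℕ → ℂ} (hF : QDiffBound q R B F) (hG : QDiffBound q R B' G)
    (K : ℕ → ℝ) (hK1 : ∀ i, 1 ≤ K i) (hK : ∀ i, ‖q‖ ^ i * K i + K (i + 1) ≤ (1 + ε) * K i)
    (j : ℕ) : ∀ i l L : ℕ,
    ‖((qDiff q)^[j] fun L => ((qDiff q)^[l] G) (L + i) * ((qDiff q)^[i] F) L) L‖
      ≤ B * B' * R ^ (i + l) * ((1 + ε) * R) ^ j * K i := by
  have hB : 0 ≤ B := by
    have := (norm_nonneg _).trans (hF 0 0)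
    simpa using this
  have hB' : 0 ≤ B' := by
    have := (norm_nonneg _).trans (hG 0 0)
    simpa using this
  induction j with
  | zero =>
    intro i l L
    rw [Function.iterate_zero, id, norm_mul, pow_zero, mul_one]
    calc _ ≤ (B' * R ^ l) * (B * R ^ i) :=
          mul_le_mul (hG _ _) (hF _ _) (norm_nonneg _) (by positivity)
      _ = B * B' * R ^ (i + l) * 1 := by ring
      _ ≤ _ := mul_le_mul_of_nonneg_left (hK1 i) (by positivity)
  | succ j ih =>
    intro i l L
    have e : (qDiff q fun L => ((qDiff q)^[l] G) (L + i) * ((qDiff q)^[i] F) L)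
        = fun L => q ^ i * (((qDiff q)^[l + 1] G) (L + i) * ((qDiff q)^[i] F) L)
          + ((qDiff q)^[l] G) (L + (i + 1)) * ((qDiff q)^[i + 1] F) L := by
      funext L
      rw [Function.iterate_succ_apply', Function.iterate_succ_apply']
      simp only [qDiff]
      have h1 := pow_ne_zero L hq0
      have h2 := pow_ne_zero i hq0
      rw [show L + 1 + i = L + i + 1 by ring, show L + (i + 1) = L + i + 1 by ring, pow_add]
      field_simp
      ring
    rw [Function.iterate_succ_apply, e, qDiff_iterate_add, qDiff_iterate_const_mul]
    refine (norm_add_le _ _).trans ?_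
    rw [norm_mul, norm_pow]
    have h1 := mul_le_mul_of_nonneg_left (ih i (l + 1) L) (pow_nonneg (norm_nonneg q) i)
    have h2 := ih (i + 1) l L
    have h3 := mul_le_mul_of_nonneg_left (hK i)
      (show 0 ≤ B * B' * R ^ (i + l + 1) * ((1 + ε) * R) ^ j by positivity)
    calc _ ≤ _ := add_le_add h1 h2
      _ = B * B' * R ^ (i + l + 1) * ((1 + ε) * R) ^ j * (‖q‖ ^ i * K i + K (i + 1)) := by ring
      _ ≤ _ := h3
      _ = _ := by ring

theorem QDiffBound.exists_mul {q : ℂ} (hq0 : q ≠ 0) (hq : ‖q‖ < 1) {R B B' ε : ℝ} (hR : 0 ≤ R)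
    (hε : 0 < ε) (hε1 : ε ≤ 1) {F G : ℕ → ℂ} (hF : QDiffBound q R B F)
    (hG : QDiffBound q R B' G) :
    ∃ B'' : ℝ, QDiffBound q ((1 + ε) * R) B'' fun L => F L * G L := by
  obtain ⟨N, hN⟩ := exists_pow_lt_of_lt_one hε hq
  -- For `i < N` the weight drops by the factor `ε` at each step and `‖q‖^i ≤ 1` suffices. From `N`
  -- on the weight is `1` and `‖q‖^i < ε`.
  have h := norm_qDiff_iterate_mul_le hq0 hR hε hF hG (fun i => ε⁻¹ ^ (N - i))
    (fun i => one_le_pow₀ ((one_le_inv₀ hε).2 hε1)) (fun i => by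
      rcases lt_or_ge i N with hi | hi
      · rw [show N - i = (N - (i + 1)) + 1 by omega, pow_succ]
        have h1 : ‖q‖ ^ i ≤ 1 := pow_le_one₀ (norm_nonneg q) hq.le
        set u := ε⁻¹ ^ (N - (i + 1)) with hu
        have h2 : 0 < u := by positivity
        have h3 : u = u * ε⁻¹ * ε := by field_simp
        have h4 : 0 < u * ε⁻¹ := by positivity
        nlinarith [mul_le_mul_of_nonneg_right h1 h4.le]
      · rw [show N - i = 0 by omega, show N - (i + 1) = 0 by omega]
        have h1 : ‖q‖ ^ i ≤ ‖q‖ ^ N := pow_le_pow_of_le_one (norm_nonneg q) hq.le hi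
        simp only [pow_zero, mul_one]
        linarith)
  refine ⟨B * B' * ε⁻¹ ^ N, fun j L => ?_⟩
  have h1 := h j 0 0 L
  simp only [Function.iterate_zero, id, add_zero, pow_zero, mul_one, tsub_zero] at h1
  have e : (fun L => F L * G L) = fun L => G L * F L := by
    funext L
    ring
  rw [e]
  refine h1.trans (le_of_eq ?_)
  ring

/-! ### Orthogonality and the terminating expansion. -/

theorem sum_Iic_eq_sum_range_piAntidiag {n : ℕ} (k : Fin n → ℕ) (f : (Fin n → ℕ) → ℂ)
    (h : ∀ m, ¬ m ≤ k → f m = 0) :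
    ∑ m ∈ Finset.Iic k, f m
      = ∑ L ∈ Finset.range (∑ t, k t + 1), ∑ m ∈ Finset.piAntidiag Finset.univ L, f m := by
  rw [← Finset.sum_fiberwise_of_maps_to (s := Finset.Iic k)
    (t := Finset.range (∑ t, k t + 1)) (g := fun m => ∑ t, m t) (fun m hm => by
      have h2 : ∑ t, m t ≤ ∑ t, k t := Finset.sum_le_sum fun t _ => Finset.mem_Iic.1 hm t
      exact Finset.mem_range.2 (Nat.lt_succ_of_le h2))]
  refine Finset.sum_congr rfl fun L _ => ?_
  refine Finset.sum_subset (fun m hm => ?_) fun m hm hm' => ?_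
  · rw [Finset.mem_filter] at hm
    exact Finset.mem_piAntidiag.2 ⟨hm.2, fun i _ => Finset.mem_univ i⟩
  · refine h m fun hle => hm' ?_
    exact Finset.mem_filter.2 ⟨Finset.mem_Iic.2 hle, (Finset.mem_piAntidiag.1 hm).1⟩

/-- `sum_anWeight_mul_prod` with `z = α q^J` writes the level `J` as a difference of consecutive
values of the right side. The factor `A^(-J)` absorbs the `A` in its second term. -/
theorem sum_levels_telescope {n : ℕ} {q α : ℂ} {x w : Fin n → ℂ} (hx : QGeneric q x)
    (hw : ∀ r, w r ≠ 0) (hαw : ∀ r j, qPoch q (α * w r * q) j ≠ 0) (B : ℕ) :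
    ∑ J ∈ Finset.range (B + 1), (∑ j ∈ Finset.piAntidiag Finset.univ J,
        anWeight q x w j * ∏ s, (1 - α * q ^ J * qNode q x j s))
        * ((∏ r, qPoch q (α * x r) J / qPoch q (α * w r * q) J) * ((∏ t, x t / w t)⁻¹) ^ J)
      = qPoch q ((∏ t, x t / w t) * q) B / qPoch q q B
        * ((∏ r, qPoch q (α * x r) (B + 1) / qPoch q (α * w r * q) B)
          * ((∏ t, x t / w t)⁻¹) ^ B) := by
  have hA : ∏ t, x t / w t ≠ 0 :=
    Finset.prod_ne_zero_iff.2 fun t _ => div_ne_zero (hx.x_ne t) (hw t)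
  induction B with
  | zero =>
    simp [anWeight_zero hx, qNode, qPoch]
  | succ B ih =>
    rw [Finset.sum_range_succ, ih, sum_anWeight_mul_prod hx w hw]
    set A := ∏ t, x t / w t
    have e1 : ∏ r, qPoch q (α * x r) (B + 1 + 1) / qPoch q (α * w r * q) (B + 1)
        = (∏ s, (1 - α * q ^ (B + 1) * x s))
          * ∏ r, qPoch q (α * x r) (B + 1) / qPoch q (α * w r * q) (B + 1) := by
      rw [← Finset.prod_mul_distrib]
      refine Finset.prod_congr rfl fun r _ => ?_
      rw [qPoch_succ _ _ (B + 1)]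
      ring
    have e2 : ∏ r, qPoch q (α * x r) (B + 1) / qPoch q (α * w r * q) B
        = (∏ s, (1 - α * q ^ (B + 1) * w s))
          * ∏ r, qPoch q (α * x r) (B + 1) / qPoch q (α * w r * q) (B + 1) := by
      rw [← Finset.prod_mul_distrib]
      refine Finset.prod_congr rfl fun r _ => ?_
      have h1 := hαw r (B + 1)
      rw [qPoch_succ _ (α * w r * q) B] at h1 ⊢
      have h2 := left_ne_zero_of_mul h1
      have h3 := right_ne_zero_of_mul h1
      rw [mul_div_assoc', div_eq_div_iff h2 h1]
      ring
    rw [e1, e2, pow_succ (A⁻¹) B]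
    have e3 : A * A⁻¹ = 1 := mul_inv_cancel₀ hA
    linear_combination (- (qPoch q (A * q) B / qPoch q q B * (∏ s, (1 - α * q ^ (B + 1) * w s))
      * (∏ r, qPoch q (α * x r) (B + 1) / qPoch q (α * w r * q) (B + 1)) * A⁻¹ ^ B)) * e3

theorem prod_div_qNode {n : ℕ} {q : ℂ} {x : Fin n → ℂ} (hx : QGeneric q x) (M : Fin n → ℕ) :
    ∏ t, x t / qNode q x M t = (q ^ ∑ t, M t)⁻¹ := by
  rw [← prod_qNode_div hx, ← Finset.prod_inv_distrib]
  refine Finset.prod_congr rfl fun t _ => ?_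
  rw [mul_inv, inv_inv, div_eq_mul_inv]

theorem qPoch_inv_pow_eq_zero {q : ℂ} (hq : q ≠ 0) {N : ℕ} (hN : N ≠ 0) :
    qPoch q ((q ^ N)⁻¹ * q) N = 0 := by
  obtain ⟨N, rfl⟩ := Nat.exists_eq_succ_of_ne_zero hN
  refine Finset.prod_eq_zero (Finset.mem_range.2 (Nat.lt_succ_self N)) ?_
  rw [Nat.succ_eq_add_one, mul_assoc, ← pow_succ', inv_mul_cancel₀ (pow_ne_zero _ hq), sub_self]

/-- Here `A = q^(-|M|)`, so the telescoped sum up to `|M|` carries the factor `(q^(1-|M|))_|M|`,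
which is zero once `|M| ≥ 1`. -/
theorem sum_Iic_orthogonality {n : ℕ} {q α : ℂ} {x : Fin n → ℂ} (hx : QGeneric q x)
    (M : Fin n → ℕ) (hα : ∀ r j, qPoch q (α * qNode q x M r * q) j ≠ 0) :
    ∑ j ∈ Finset.Iic M, anWeight q x (qNode q x M) j
        * (∏ s, (1 - α * q ^ (∑ t, j t) * qNode q x j s))
        * ((∏ r, qPoch q (α * x r) (∑ t, j t) / qPoch q (α * qNode q x M r * q) (∑ t, j t))
          * (q ^ ∑ t, M t) ^ (∑ t, j t))
      = if M = 0 then ∏ r, (1 - α * x r) else 0 := by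
  rw [sum_Iic_eq_sum_range_piAntidiag _ _ fun m hm => by
    rw [anWeight_qNode_eq_zero hx M m hm, zero_mul, zero_mul]]
  have h := sum_levels_telescope hx (hx.qNode_ne M) hα (∑ t, M t)
  rw [prod_div_qNode hx, inv_inv] at h
  have e : ∀ J, ∑ j ∈ Finset.piAntidiag Finset.univ J, anWeight q x (qNode q x M) j
        * (∏ s, (1 - α * q ^ (∑ t, j t) * qNode q x j s))
        * ((∏ r, qPoch q (α * x r) (∑ t, j t) / qPoch q (α * qNode q x M r * q) (∑ t, j t))
          * (q ^ ∑ t, M t) ^ (∑ t, j t))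
      = (∑ j ∈ Finset.piAntidiag Finset.univ J,
        anWeight q x (qNode q x M) j * ∏ s, (1 - α * q ^ J * qNode q x j s))
        * ((∏ r, qPoch q (α * x r) J / qPoch q (α * qNode q x M r * q) J)
          * (q ^ ∑ t, M t) ^ J) := by
    intro J
    rw [Finset.sum_mul]
    refine Finset.sum_congr rfl fun j hj => ?_
    rw [(Finset.mem_piAntidiag.1 hj).1]
  simp only [e]
  rw [h]
  split_ifs with hM
  · subst hM
    simp [qPoch]
  · have : ∑ t, M t ≠ 0 := fun h0 => hM (by
      funext t
      exact (Finset.sum_eq_zero_iff.1 h0) t (Finset.mem_univ t))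
    rw [qPoch_inv_pow_eq_zero hx.q_ne this, zero_div, zero_mul]

theorem qPoch_reverse {q Z : ℂ} (hq : q ≠ 0) (hZ : Z ≠ 0) (j : ℕ) :
    qPoch q (q * Z) j
      = (-Z) ^ j * (∏ i ∈ Finset.range j, q ^ (i + 1)) * qPoch q (Z⁻¹ * (q ^ j)⁻¹) j := by
  induction j with
  | zero => simp [qPoch_zero]
  | succ j ih =>
    have e : Z⁻¹ * (q ^ (j + 1))⁻¹ * q = Z⁻¹ * (q ^ j)⁻¹ := by
      rw [pow_succ]
      field_simp
    have e2 : (1 - q * Z * q ^ j) = -Z * q ^ (j + 1) * (1 - Z⁻¹ * (q ^ (j + 1))⁻¹) := by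
      have := pow_ne_zero (j + 1) hq
      field_simp
      ring
    rw [qPoch_succ, ih, qPoch_succ', e, e2, Finset.prod_range_succ]
    ring

theorem qPoch_mul_qPoch_shift {q X : ℂ} (hq : q ≠ 0) (hX : X ≠ 0) (j b : ℕ) :
    qPoch q (X⁻¹ * (q ^ j)⁻¹) b * qPoch q (q * (X / q ^ b)) j * q ^ (j * b)
      = qPoch q X⁻¹ b * qPoch q (q * X) j := by
  have hb := pow_ne_zero b hq
  have hj := pow_ne_zero j hq
  rw [qPoch_reverse hq (div_ne_zero hX hb), qPoch_reverse hq hX]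
  have h1 := qPoch_add q (X⁻¹ * (q ^ j)⁻¹) b j
  rw [add_comm, qPoch_add] at h1
  have e1 : X⁻¹ * (q ^ j)⁻¹ * q ^ j = X⁻¹ := by field_simp
  have e2 : (X / q ^ b)⁻¹ * (q ^ j)⁻¹ = X⁻¹ * (q ^ j)⁻¹ * q ^ b := by
    rw [inv_div]
    field_simp
  have e3 : (-(X / q ^ b)) ^ j * q ^ (j * b) = (-X) ^ j := by
    rw [mul_comm j b, pow_mul, ← mul_pow]
    congr 1
    field_simp
  rw [e1] at h1
  rw [e2]
  linear_combination (qPoch q (X⁻¹ * (q ^ j)⁻¹) b * (∏ i ∈ Finset.range j, q ^ (i + 1))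
    * qPoch q (X⁻¹ * (q ^ j)⁻¹ * q ^ b) j) * e3
    - (-X) ^ j * (∏ i ∈ Finset.range j, q ^ (i + 1)) * h1

/-- Factors the product of the outer weight at `m + j` and the inner weight at `m` into a part
depending on `m` alone and a weight in `j` based at `x q^m`, to which orthogonality applies. The
`q`-power comes from reversing shifted factorials. -/
theorem anWeight_add_mul {n : ℕ} {q : ℂ} {x : Fin n → ℂ} (hx : QGeneric q x) (w : Fin n → ℂ)
    (m j : Fin n → ℕ) :
    anWeight q x w (m + j) * anWeight q x (qNode q x (m + j)) m * q ^ ((∑ t, j t) * ∑ t, m t)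
      = anWeight q x w m * anWeight q x (qNode q x m) m * anWeight q (qNode q x m) w j := by
  have hq := hx.q_ne
  have key : (∏ r, ∏ s, qPoch q (x r / qNode q x (m + j) s) (m r))
      * (∏ r, ∏ s, qPoch q (q * qNode q x m r / qNode q x m s) (j r))
      * q ^ ((∑ t, j t) * ∑ t, m t)
      = (∏ r, ∏ s, qPoch q (x r / qNode q x m s) (m r))
      * ∏ r, ∏ s, qPoch q (q * qNode q x m r / x s) (j r) := by
    have e : q ^ ((∑ t, j t) * ∑ t, m t) = ∏ r, ∏ s, q ^ (j r * m s) := by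
      simp only [Finset.prod_pow_eq_pow_sum, ← Finset.mul_sum, ← Finset.sum_mul]
    rw [e, Finset.prod_comm (f := fun r s => qPoch q (x r / qNode q x (m + j) s) (m r)),
      Finset.prod_comm (f := fun r s => qPoch q (x r / qNode q x m s) (m r))]
    simp only [← Finset.prod_mul_distrib]
    refine Finset.prod_congr rfl fun r _ => Finset.prod_congr rfl fun s _ => ?_
    have h1 := hx.x_ne s
    have h2 := hx.qNode_ne m r
    have h := qPoch_mul_qPoch_shift hq (div_ne_zero h2 h1) (j r) (m s)
    have e1 : (qNode q x m r / x s)⁻¹ * (q ^ j r)⁻¹ = x s / qNode q x (m + j) r := by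
      simp only [qNode, Pi.add_apply, pow_add]
      rw [inv_div]
      field_simp
    have e2 : q * (qNode q x m r / x s / q ^ m s) = q * qNode q x m r / qNode q x m s := by
      rw [div_div, mul_div_assoc']
      rfl
    rw [e1, e2, inv_div, mul_div_assoc'] at h
    exact h
  have hD : ∏ r, ∏ s, qPoch q (q * qNode q x m r / qNode q x m s) (j r) ≠ 0 :=
    Finset.prod_ne_zero_iff.2 fun r _ => Finset.prod_ne_zero_iff.2 fun s _ =>
      (hx.shift m).qPoch_ne r s _
  have hD1 : ∏ r, ∏ s, qPoch q (q * qNode q x m r / x s) (j r) ≠ 0 := by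
    refine Finset.prod_ne_zero_iff.2 fun r _ => Finset.prod_ne_zero_iff.2 fun s _ => ?_
    have h1 := hx.qPoch_ne r s (m r + j r)
    rw [qPoch_add] at h1
    have h2 := right_ne_zero_of_mul h1
    rwa [div_mul_eq_mul_div, mul_assoc] at h2
  have hsplit : ∏ r, ∏ s, qPoch q (x r / w s) ((m + j) r) / qPoch q (q * x r / x s) ((m + j) r)
      = (∏ r, ∏ s, qPoch q (x r / w s) (m r) / qPoch q (q * x r / x s) (m r))
        * ((∏ r, ∏ s, qPoch q (qNode q x m r / w s) (j r))
          / ∏ r, ∏ s, qPoch q (q * qNode q x m r / x s) (j r)) := by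
    simp only [← Finset.prod_div_distrib, ← Finset.prod_mul_distrib]
    refine Finset.prod_congr rfl fun r _ => Finset.prod_congr rfl fun s _ => ?_
    rw [Pi.add_apply, qPoch_add, qPoch_add, div_mul_eq_mul_div, div_mul_eq_mul_div, mul_assoc q,
      mul_div_mul_comm]
    rfl
  simp only [anWeight, vdmQuot_add hx]
  rw [hsplit]
  simp only [Finset.prod_div_distrib]
  have hE : ∏ r, ∏ s, qPoch q (q * x r / x s) (m r) ≠ 0 :=
    Finset.prod_ne_zero_iff.2 fun r _ => Finset.prod_ne_zero_iff.2 fun s _ => hx.qPoch_ne r s _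
  set P1 := ∏ r, ∏ s, qPoch q (x r / qNode q x (m + j) s) (m r)
  set P2 := ∏ r, ∏ s, qPoch q (x r / qNode q x m s) (m r)
  set D2 := ∏ r, ∏ s, qPoch q (q * qNode q x m r / qNode q x m s) (j r)
  set D1 := ∏ r, ∏ s, qPoch q (q * qNode q x m r / x s) (j r)
  set E := ∏ r, ∏ s, qPoch q (q * x r / x s) (m r)
  set W1 := ∏ r, ∏ s, qPoch q (x r / w s) (m r)
  set W2 := ∏ r, ∏ s, qPoch q (qNode q x m r / w s) (j r)
  field_simp
  linear_combination (vdmQuot q x m ^ 2 * W1 * W2 * vdmQuot q (qNode q x m) j) * key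

theorem qPoch_inv_pow_div_sq {q : ℂ} (hq0 : q ≠ 0) (hq : ∀ k : ℕ, q ^ (k + 1) ≠ 1) (N : ℕ) :
    (qPoch q ((q ^ N)⁻¹) N / qPoch q q N) ^ 2 * q ^ (N * (N + 1)) = 1 := by
  induction N with
  | zero => simp [qPoch_zero]
  | succ N ih =>
    have e : (q ^ (N + 1))⁻¹ * q = (q ^ N)⁻¹ := by
      rw [pow_succ]
      field_simp
    have h1 := qPoch_self_ne hq N
    have h2 : 1 - q * q ^ N ≠ 0 := by
      rw [← pow_succ']
      exact sub_ne_zero.2 (hq N).symm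
    have e2 : (1 - (q ^ (N + 1))⁻¹) = -(q ^ (N + 1))⁻¹ * (1 - q * q ^ N) := by
      have := pow_ne_zero (N + 1) hq0
      rw [← pow_succ']
      field_simp
      ring
    have e3 : (N + 1) * (N + 1 + 1) = N * (N + 1) + (N + 1) + (N + 1) := by ring
    rw [qPoch_succ', e, e2, qPoch_succ, mul_assoc, mul_comm (qPoch q q N), mul_div_assoc,
      mul_div_mul_left _ _ h2, mul_pow, e3, pow_add, pow_add]
    have h3 := pow_ne_zero (N + 1) hq0
    calc _ = ((qPoch q (q ^ N)⁻¹ N / qPoch q q N) ^ 2 * q ^ (N * (N + 1)))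
          * ((q ^ (N + 1))⁻¹ * q ^ (N + 1)) ^ 2 := by ring
      _ = 1 := by rw [ih, inv_mul_cancel₀ h3]; norm_num

/-- In `sum_anWeight` at the level `|M|` only `m = M` survives, so the weight is `(q^(-N))_N /
(q)_N` with `N = |M|`, that is `q^(-N(N+1)/2)` up to sign. Squaring removes the sign. -/
theorem anWeight_self_sq {n : ℕ} {q : ℂ} {x : Fin n → ℂ} (hx : QGeneric q x) (M : Fin n → ℕ) :
    anWeight q x (qNode q x M) M ^ 2 * q ^ ((∑ t, M t) * (∑ t, M t + 1)) = 1 := by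
  have h := sum_anWeight hx (qNode q x M) (hx.qNode_ne M) (∑ t, M t)
  rw [prod_div_qNode hx] at h
  rw [Finset.sum_eq_single_of_mem M (Finset.mem_piAntidiag.2 ⟨rfl, fun i _ => Finset.mem_univ i⟩)
    (fun m hm hne => anWeight_qNode_eq_zero hx M m fun hle => hne (by
      have h1 := (Finset.mem_piAntidiag.1 hm).1
      have h2 := (Finset.sum_eq_sum_iff_of_le fun i _ => hle i).1 h1
      funext i
      exact h2 i (Finset.mem_univ i)))] at h
  rw [h]
  exact qPoch_inv_pow_div_sq hx.q_ne hx.pow_ne _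

/-- Inversion of a triangular matrix: the `m`-sum goes outside, and the sum over `k` between `m` and
`M` is an orthogonality sum that vanishes unless `m = M`. The diagonal entry is normalised by
`anWeight_self_sq`. -/
theorem terminating_expansion {n : ℕ} {q α : ℂ} {x : Fin n → ℂ} (hx : QGeneric q x)
    (M : Fin n → ℕ) (hα : ∀ r j, qPoch q (α * qNode q x M r * q) j ≠ 0)
    (hαx : ∀ r, 1 - α * x r ≠ 0) (G : (Fin n → ℕ) → ℂ) :
    ∑ k ∈ Finset.Iic M, anWeight q x (qNode q x M) k
        * (∏ r, (1 - α * q ^ (∑ t, k t) * qNode q x k r) / (1 - α * x r))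
        * (∏ r, qPoch q (α * x r) (∑ t, k t) / qPoch q (α * qNode q x M r * q) (∑ t, k t))
        * (q ^ ∑ t, M t) ^ (∑ t, k t)
        * (∑ m ∈ Finset.Iic k, anWeight q x (qNode q x k) m
          * (∏ r, qPoch q (α * x r * q ^ (∑ t, k t)) (m r)) * (q ^ (∑ t, m t) * G m))
      = (∏ r, qPoch q (α * q * x r) (M r)) * G M := by
  have hq := hx.q_ne
  set w := qNode q x M with hw
  simp only [Finset.mul_sum]
  rw [Finset.sum_comm' (s := Finset.Iic M) (t := fun k => Finset.Iic k) (t' := Finset.Iic M)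
    (s' := fun m => Finset.Icc m M) (fun k m => by
      simp only [Finset.mem_Iic, Finset.mem_Icc]
      exact ⟨fun h => ⟨⟨h.2, h.1⟩, h.2.trans h.1⟩, fun h => ⟨h.1.2, h.1.1⟩⟩)]
  -- With `k = m + j`, the inner sum is `sum_Iic_orthogonality` for the base point `x q^m`, the
  -- parameter `α q^|m|` and the bound `M - m`; the point `w` is unchanged.
  have hterm : ∀ m ∈ Finset.Iic M, ∑ k ∈ Finset.Icc m M, anWeight q x w k
        * (∏ r, (1 - α * q ^ (∑ t, k t) * qNode q x k r) / (1 - α * x r))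
        * (∏ r, qPoch q (α * x r) (∑ t, k t) / qPoch q (α * w r * q) (∑ t, k t))
        * (q ^ ∑ t, M t) ^ (∑ t, k t)
        * (anWeight q x (qNode q x k) m
          * (∏ r, qPoch q (α * x r * q ^ (∑ t, k t)) (m r)) * (q ^ (∑ t, m t) * G m))
      = (q ^ (∑ t, m t) * G m) * (anWeight q x w m * anWeight q x (qNode q x m) m
        * (∏ r, qPoch q (α * x r) (∑ t, m t + m r)
            / ((1 - α * x r) * qPoch q (α * w r * q) (∑ t, m t)))
        * (q ^ ∑ t, M t) ^ (∑ t, m t))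
        * if M - m = 0 then ∏ r, (1 - α * q ^ (∑ t, m t) * qNode q x m r) else 0 := by
    intro m hm
    have hmM : m ≤ M := Finset.mem_Iic.1 hm
    have hnode : qNode q (qNode q x m) (M - m) = w := by
      funext r
      simp only [qNode, hw, Pi.sub_apply]
      rw [mul_assoc, ← pow_add, Nat.add_sub_cancel' (hmM r)]
    have horth := sum_Iic_orthogonality (α := α * q ^ (∑ t, m t)) (hx.shift m) (M - m)
      (fun r j => by
        have h1 := hα r (∑ t, m t + j)
        rw [qPoch_add] at h1
        have h2 := right_ne_zero_of_mul h1
        rw [hnode]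
        convert h2 using 2
        ring)
    rw [hnode] at horth
    rw [← horth, Finset.mul_sum]
    refine Finset.sum_bij' (fun k _ => k - m) (fun j _ => m + j) ?_ ?_ ?_ ?_ ?_
    · intro k hk
      rw [Finset.mem_Icc] at hk
      exact Finset.mem_Iic.2 (tsub_le_tsub_right hk.2 m)
    · intro j hj
      rw [Finset.mem_Iic] at hj
      refine Finset.mem_Icc.2 ⟨le_self_add, ?_⟩
      calc m + j ≤ m + (M - m) := by gcongr
        _ = M := add_tsub_cancel_of_le hmM
    · intro k hk
      exact add_tsub_cancel_of_le (Finset.mem_Icc.1 hk).1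
    · intro j _
      exact add_tsub_cancel_left m j
    · intro k hk
      obtain ⟨j, rfl⟩ : ∃ j, k = m + j :=
        ⟨k - m, (add_tsub_cancel_of_le (Finset.mem_Icc.1 hk).1).symm⟩
      rw [add_tsub_cancel_left]
      have hsum : ∑ t, (m + j) t = ∑ t, m t + ∑ t, j t := by
        simp [Finset.sum_add_distrib]
      have hsumM : ∑ t, M t = ∑ t, m t + ∑ t, (M - m) t := by
        rw [← Finset.sum_add_distrib]
        refine Finset.sum_congr rfl fun t _ => ?_
        rw [Pi.sub_apply, Nat.add_sub_cancel' (hmM t)]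
      have hwt := anWeight_add_mul hx w m j
      rw [hsum]
      set μ := ∑ t, m t with hμ
      set J := ∑ t, j t with hJ
      set ν := ∑ t, (M - m) t with hν
      have e1 : (∏ r, (1 - α * q ^ (μ + J) * qNode q x (m + j) r) / (1 - α * x r))
          * (∏ r, qPoch q (α * x r) (μ + J) / qPoch q (α * w r * q) (μ + J))
          * (∏ r, qPoch q (α * x r * q ^ (μ + J)) (m r))
          = (∏ r, qPoch q (α * x r) (μ + m r) / ((1 - α * x r) * qPoch q (α * w r * q) μ))
          * (∏ s, (1 - α * q ^ μ * q ^ J * qNode q (qNode q x m) j s))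
          * ∏ r, qPoch q (α * q ^ μ * qNode q x m r) J / qPoch q (α * q ^ μ * w r * q) J := by
        simp only [← Finset.prod_mul_distrib]
        refine Finset.prod_congr rfl fun r _ => ?_
        have h1 : qPoch q (α * x r) (μ + J) * qPoch q (α * x r * q ^ (μ + J)) (m r)
            = qPoch q (α * x r) (μ + m r) * qPoch q (α * q ^ μ * qNode q x m r) J := by
          rw [← qPoch_add, show μ + J + m r = μ + m r + J by ring, qPoch_add, qNode, pow_add]
          congr 2
          ring
        have h2 : qPoch q (α * w r * q) (μ + J)
            = qPoch q (α * w r * q) μ * qPoch q (α * q ^ μ * w r * q) J := by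
          rw [qPoch_add]
          congr 2
          ring
        have h3 : α * q ^ (μ + J) * qNode q x (m + j) r
            = α * q ^ μ * q ^ J * qNode q (qNode q x m) j r := by
          simp only [qNode, Pi.add_apply, pow_add]
          ring
        have h4 := hα r (μ + J)
        rw [h2] at h4
        have h5 := left_ne_zero_of_mul h4
        have h6 := right_ne_zero_of_mul h4
        have h7 := hαx r
        rw [h2, h3]
        calc _ = ((1 - α * q ^ μ * q ^ J * qNode q (qNode q x m) j r) / (1 - α * x r))
              * (qPoch q (α * x r) (μ + J) * qPoch q (α * x r * q ^ (μ + J)) (m r))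
              / (qPoch q (α * w r * q) μ * qPoch q (α * q ^ μ * w r * q) J) := by ring
          _ = _ := by
            rw [h1]
            field_simp
      -- Splitting `|M| = |m| + |M - m|` in the exponent releases the factor `q^(|j| |m|)` required
      -- by `anWeight_add_mul`.
      have e2 : (q ^ ∑ t, M t) ^ (μ + J) = (q ^ ∑ t, M t) ^ μ * (q ^ ν) ^ J * q ^ (J * μ) := by
        rw [hsumM, ← pow_mul, ← pow_mul, ← pow_mul, ← pow_add, ← pow_add]
        congr 1
        ring
      rw [e2]
      linear_combination (q ^ μ * G m * (q ^ ∑ t, M t) ^ μ * (q ^ ν) ^ J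
          * (anWeight q x w (m + j) * anWeight q x (qNode q x (m + j)) m * q ^ (J * μ))) * e1
        + (q ^ μ * G m * (q ^ ∑ t, M t) ^ μ * (q ^ ν) ^ J
          * ((∏ r, qPoch q (α * x r) (μ + m r) / ((1 - α * x r) * qPoch q (α * w r * q) μ))
          * (∏ s, (1 - α * q ^ μ * q ^ J * qNode q (qNode q x m) j s))
          * ∏ r, qPoch q (α * q ^ μ * qNode q x m r) J
            / qPoch q (α * q ^ μ * w r * q) J)) * hwt
  rw [Finset.sum_congr rfl hterm, Finset.sum_eq_single_of_mem M (Finset.mem_Iic.2 le_rfl)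
    (fun m hm hne => by
      rw [if_neg, mul_zero]
      intro h0
      exact hne (le_antisymm (Finset.mem_Iic.1 hm) (tsub_eq_zero_iff_le.1 h0))),
    tsub_self, if_pos rfl]
  have hsq := anWeight_self_sq hx M
  rw [← hw] at hsq ⊢
  set μ := ∑ t, M t
  have e1 : (∏ r, qPoch q (α * x r) (μ + M r) / ((1 - α * x r) * qPoch q (α * w r * q) μ))
      * (∏ r, (1 - α * q ^ μ * w r)) = ∏ r, qPoch q (α * q * x r) (M r) := by
    rw [← Finset.prod_mul_distrib]
    refine Finset.prod_congr rfl fun r _ => ?_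
    have h1 := qPoch_succ q (α * x r) (μ + M r)
    have h2 := hα r μ
    have h3 := hαx r
    rw [show μ + M r + 1 = M r + μ + 1 by ring, qPoch_succ', qPoch_add,
      show α * x r * q * q ^ M r = α * w r * q by rw [hw, qNode]; ring,
      show α * x r * q ^ (μ + M r) = α * q ^ μ * w r by rw [hw, qNode, pow_add]; ring,
      show α * x r * q = α * q * x r by ring] at h1
    rw [div_mul_eq_mul_div, ← h1, div_eq_iff (mul_ne_zero h3 h2)]
    ring
  have e2 : q ^ (μ * (μ + 1)) = q ^ μ * (q ^ μ) ^ μ := by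
    rw [← pow_mul, ← pow_add]
    congr 1
    ring
  rw [e2] at hsq
  rw [← e1]
  linear_combination (G M * (∏ r, qPoch q (α * x r) (μ + M r)
    / ((1 - α * x r) * qPoch q (α * w r * q) μ)) * (∏ r, (1 - α * q ^ μ * w r))) * hsq

/-! ### Analyticity of infinite products and summability over multi-indices. -/

theorem differentiable_qPochInf {q : ℂ} (hq : ‖q‖ < 1) : Differentiable ℂ (qPochInf q) := by
  intro z
  have h : HasProdLocallyUniformlyOn (fun (i : ℕ) (z : ℂ) => 1 + -(z * q ^ i))
      (fun z => ∏' i : ℕ, (1 + -(z * q ^ i))) (Metric.ball 0 (‖z‖ + 1)) :=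
    Summable.hasProdLocallyUniformlyOn_nat_one_add Metric.isOpen_ball
      ((summable_geometric_of_lt_one (norm_nonneg q) hq).mul_left (‖z‖ + 1))
      (Filter.Eventually.of_forall fun i y hy => by
        rw [mem_ball_zero_iff] at hy
        rw [norm_neg, norm_mul, norm_pow]
        gcongr) (fun i => by fun_prop)
  have h2 := h.differentiableOn (Filter.Eventually.of_forall fun s => by
    simpa [Finset.prod_fn] using DifferentiableOn.finsetProd (fun _ _ => by fun_prop))
    Metric.isOpen_ball
  have e : (fun z => ∏' i : ℕ, (1 + -(z * q ^ i))) = qPochInf q := by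
    funext z
    simp only [← sub_eq_add_neg]
    rfl
  rw [e] at h2
  exact h2.differentiableAt (Metric.isOpen_ball.mem_nhds (by simp))

theorem summable_pow_sum (n : ℕ) {θ : ℝ} (h0 : 0 ≤ θ) (h1 : θ < 1) :
    Summable fun k : Fin n → ℕ => θ ^ (∑ t, k t) := by
  refine summable_of_sum_le (c := ((1 - θ)⁻¹) ^ n) (fun k => by positivity) fun s => ?_
  obtain ⟨B, hB⟩ : ∃ B, s ⊆ Fintype.piFinset fun _ : Fin n => Finset.range B := by
    refine ⟨s.sup (fun k => ∑ t, k t) + 1, fun k hk => ?_⟩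
    rw [Fintype.mem_piFinset]
    intro t
    refine Finset.mem_range.2 (Nat.lt_succ_of_le ?_)
    exact (Finset.single_le_sum (fun i _ => Nat.zero_le (k i)) (Finset.mem_univ t)).trans
      (Finset.le_sup (f := fun k : Fin n → ℕ => ∑ t, k t) hk)
  refine (Finset.sum_le_sum_of_subset_of_nonneg hB fun k _ _ => by positivity).trans ?_
  simp only [← Finset.prod_pow_eq_pow_sum]
  rw [← Finset.prod_univ_sum (fun _ : Fin n => Finset.range B) fun _ i => θ ^ i,
    Finset.prod_const, Finset.card_univ, Fintype.card_fin]
  refine pow_le_pow_left₀ (Finset.sum_nonneg fun i _ => by positivity) ?_ n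
  rw [← tsum_geometric_of_lt_one h0 h1]
  exact (summable_geometric_of_lt_one h0 h1).sum_le_tsum _ fun i _ => by positivity

/-! ### The summands of the theorem in terms of the weights. -/

/-- The power of `q` contributes `q^(k_s)` to each pair `r < s`, which clears the negative power in
`1 - q^(k_r - k_s) x_r / x_s`. -/
theorem anFactor_mul_pow {n : ℕ} {q : ℂ} {x : Fin n → ℂ} (hx : QGeneric q x)
    (k : Fin n → ℕ) :
    anFactor q x k * q ^ (∑ r : Fin n, (r : ℕ) * k r) = vdmQuot q x k := by
  have e : ∑ r : Fin n, (r : ℕ) * k r = ∑ r, ∑ s ∈ Finset.Ioi r, k s := by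
    rw [Finset.sum_comm' (t' := Finset.univ) (s' := fun s => Finset.Iio s) (by simp)]
    simp
  rw [e, ← Finset.prod_pow_eq_pow_sum, anFactor, vdmQuot, ← Finset.prod_mul_distrib]
  refine Finset.prod_congr rfl fun r _ => ?_
  rw [← Finset.prod_pow_eq_pow_sum, ← Finset.prod_mul_distrib]
  refine Finset.prod_congr rfl fun s hs => ?_
  have h1 := hx.sub_ne (Finset.mem_Ioi.1 hs).ne
  have h2 := hx.sub_ne (Finset.mem_Ioi.1 hs).ne'
  have h3 := hx.x_ne s
  have h4 := pow_ne_zero (k s) hx.q_ne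
  rw [zpow_sub₀ hx.q_ne, zpow_natCast, zpow_natCast, one_sub_div h3, qNode, qNode]
  field_simp
  ring

/-- The coefficients `(αβ, αγ)_L / (αc, αd)_L`. -/
noncomputable def innerCoeff (q α c d β γ : ℂ) (L : ℕ) : ℂ :=
  (qPoch q (α * β) L / qPoch q (α * c) L) * (qPoch q (α * γ) L / qPoch q (α * d) L)

theorem anInnerSum_eq {n : ℕ} {q : ℂ} {x : Fin n → ℂ} (hx : QGeneric q x)
    (α b c d β γ : ℂ) (k : Fin n → ℕ) :
    anInnerSum q α b c d β γ x k
      = ∑ m ∈ Finset.Iic k, anWeight q x (qNode q x k) m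
        * (∏ r, qPoch q (α * x r * q ^ (∑ t, k t)) (m r) / qPoch q (α * b * x r) (m r))
        * (q ^ (∑ t, m t) * innerCoeff q α c d β γ (∑ t, m t)) := by
  refine Finset.sum_congr rfl fun m _ => ?_
  have e1 : q ^ (∑ r : Fin n, ((r : ℕ) + 1) * m r)
      = q ^ (∑ r : Fin n, (r : ℕ) * m r) * q ^ ∑ t, m t := by
    rw [← pow_add, ← Finset.sum_add_distrib]
    congr 1
    exact Finset.sum_congr rfl fun r _ => by ring
  have e2 : ∀ r s, q ^ (-(k s : ℤ)) * x r / x s = x r / qNode q x k s := by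
    intro r s
    rw [zpow_neg, zpow_natCast, qNode, mul_div_assoc, ← div_eq_inv_mul, div_div]
  simp only [multiDeg, e1, e2]
  rw [innerCoeff, anWeight, ← anFactor_mul_pow hx m]
  ring

theorem anInnerSum_eq_dualSum {n : ℕ} {q : ℂ} {x : Fin n → ℂ} (hx : QGeneric q x)
    (α b c d β γ : ℂ) (k : Fin n → ℕ) :
    anInnerSum q α b c d β γ x k
      = dualSum q (α * q ^ (∑ t, k t)) (α * b) x k (innerCoeff q α c d β γ) := by
  rw [anInnerSum_eq hx, sum_Iic_eq_sum_range_piAntidiag _ _ fun m hm => by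
    rw [anWeight_qNode_eq_zero hx k m hm, zero_mul, zero_mul], dualSum]
  refine Finset.sum_congr rfl fun L _ => ?_
  rw [dualLevel, Finset.sum_mul]
  refine Finset.sum_congr rfl fun m hm => ?_
  rw [(Finset.mem_piAntidiag.1 hm).1]
  simp only [mul_right_comm α _ (q ^ (∑ t, k t))]

theorem anOuterTerm_eq {n : ℕ} {q : ℂ} {x : Fin n → ℂ} (hx : QGeneric q x)
    (α b c d β γ : ℂ) (a : Fin n → ℂ) (k : Fin n → ℕ) :
    anOuterTerm q α b c d β γ x a k
      = anWeight q x (fun s => x s * a s / q) k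
        * (∏ r, (1 - α * q ^ (∑ t, k t) * qNode q x k r) / (1 - α * x r))
        * (∏ r, qPoch q (α * x r) (∑ t, k t) / qPoch q (α * x r * a r) (∑ t, k t))
        * ((∏ r, a r) / q ^ n) ^ (∑ t, k t)
        * anInnerSum q α b c d β γ x k := by
  have e1 : q ^ (((∑ r : Fin n, (r : ℕ) * k r : ℕ) : ℤ) - (n : ℤ) * (multiDeg k : ℤ))
      = q ^ (∑ r : Fin n, (r : ℕ) * k r) / (q ^ n) ^ (∑ t, k t) := by
    rw [zpow_sub₀ hx.q_ne, zpow_natCast, ← Nat.cast_mul, zpow_natCast, pow_mul]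
    rfl
  have e2 : ∀ r s, q * x r / (x s * a s) = x r / (x s * a s / q) := by
    intro r s
    rw [div_div_eq_mul_div, mul_comm]
  have e3 : ∀ r, 1 - α * x r * q ^ (k r + multiDeg k)
      = 1 - α * q ^ (∑ t, k t) * qNode q x k r := by
    intro r
    rw [qNode, pow_add, multiDeg]
    ring
  rw [anOuterTerm, e1]
  simp only [e2, e3]
  rw [anWeight, ← anFactor_mul_pow hx k, div_pow]
  simp only [multiDeg]
  ring

/-! ### Regularised summands, entire in the `a_r`. -/

/-- The outer summand multiplied by `∏ (α a_r x_r)_∞`, as an entire function of each `a_r`; the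
inner sum is the argument `I`. -/
noncomputable def regTerm {n : ℕ} (q α : ℂ) (x a : Fin n → ℂ) (k : Fin n → ℕ) (I : ℂ) : ℂ :=
  vdmQuot q x k
    * (∏ r, ∏ s, (∏ i ∈ Finset.range (k r), (a s - q * x r / x s * q ^ i))
        / qPoch q (q * x r / x s) (k r))
    * ((q ^ n) ^ (∑ t, k t))⁻¹
    * (∏ r, (1 - α * q ^ (∑ t, k t) * qNode q x k r) / (1 - α * x r))
    * (∏ r, qPoch q (α * x r) (∑ t, k t) * qPochInf q (α * x r * a r * q ^ (∑ t, k t)))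
    * I

/-- The power `(∏ a_s)^|k|` gives one `a_s` to each factor of `(q x_r / (x_s a_s))_(k_r)` and so
removes the singularity at `a_s = 0`. The infinite product cancels the denominators `(α x_r
a_r)_|k|`. -/
theorem anOuterTerm_mul_eq_regTerm {n : ℕ} {q : ℂ} {x : Fin n → ℂ} (hx : QGeneric q x)
    (hq : ‖q‖ < 1) (α b c d β γ : ℂ) (a : Fin n → ℂ) (ha : ∀ r, a r ≠ 0)
    (hαa : ∀ r, qPochInf q (α * x r * a r) ≠ 0) (k : Fin n → ℕ) :
    anOuterTerm q α b c d β γ x a k * ∏ r, qPochInf q (α * x r * a r)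
      = regTerm q α x a k (anInnerSum q α b c d β γ x k) := by
  have e1 : (∏ r, ∏ s, (∏ i ∈ Finset.range (k r), (a s - q * x r / x s * q ^ i))
        / qPoch q (q * x r / x s) (k r))
      = (∏ r, ∏ s, qPoch q (x r / (x s * a s / q)) (k r) / qPoch q (q * x r / x s) (k r))
        * (∏ r, a r) ^ (∑ t, k t) := by
    have e : (∏ r, a r) ^ (∑ t, k t) = ∏ r : Fin n, ∏ s, a s ^ k r := by
      simp only [Finset.prod_pow, Finset.prod_pow_eq_pow_sum]
    rw [e, ← Finset.prod_mul_distrib]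
    refine Finset.prod_congr rfl fun r _ => ?_
    rw [← Finset.prod_mul_distrib]
    refine Finset.prod_congr rfl fun s _ => ?_
    have e5 : a s ^ k r = ∏ _i ∈ Finset.range (k r), a s := by simp
    rw [div_mul_eq_mul_div]
    congr 1
    rw [e5, qPoch, ← Finset.prod_mul_distrib]
    refine Finset.prod_congr rfl fun i _ => ?_
    have h1 := ha s
    have h2 := hx.x_ne s
    have h3 := hx.q_ne
    field_simp
  have e2 : (∏ r, qPoch q (α * x r) (∑ t, k t) / qPoch q (α * x r * a r) (∑ t, k t))
        * ∏ r, qPochInf q (α * x r * a r)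
      = ∏ r, qPoch q (α * x r) (∑ t, k t) * qPochInf q (α * x r * a r * q ^ (∑ t, k t)) := by
    rw [← Finset.prod_mul_distrib]
    refine Finset.prod_congr rfl fun r _ => ?_
    have h1 := qPoch_ne_zero_of_qPochInf hq (hαa r) (∑ t, k t)
    rw [qPochInf_eq_mul hq (α * x r * a r) (∑ t, k t)]
    field_simp
  rw [anOuterTerm_eq hx, regTerm, e1, ← e2, div_pow, anWeight]
  ring

theorem differentiable_regTerm_update {n : ℕ} {q : ℂ} (hq : ‖q‖ < 1) (α : ℂ)
    (x a : Fin n → ℂ) (j : Fin n) (k : Fin n → ℕ) (I : ℂ) :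
    Differentiable ℂ fun τ => regTerm q α x (Function.update a j τ) k I := by
  have hu : ∀ r, Differentiable ℂ fun τ : ℂ => Function.update a j τ r := by
    intro r
    by_cases hr : r = j
    · subst hr
      simp only [Function.update_self]
      exact differentiable_id
    · simp only [Function.update_of_ne hr]
      exact differentiable_const _
  have hP : ∀ u v : ℂ, ∀ r, Differentiable ℂ fun τ : ℂ =>
      qPochInf q (u * Function.update a j τ r * v) := fun u v r =>
    (differentiable_qPochInf hq).comp (((hu r).const_mul u).mul_const v)
  unfold regTerm
  refine Differentiable.mul_const (Differentiable.mul (Differentiable.mul_const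
    (Differentiable.mul_const (Differentiable.const_mul ?_ _) _) _) ?_) _
  · refine Differentiable.fun_finsetProd fun r _ => Differentiable.fun_finsetProd fun s _ => ?_
    refine Differentiable.div_const ?_ _
    exact Differentiable.fun_finsetProd fun i _ => (hu s).sub_const _
  · exact Differentiable.fun_finsetProd fun r _ => (hP _ _ r).const_mul _

/-- The geometric rate comes only from the factors `a_s - z q^i`, of which each `a_s` has `|k|` in
total, and from `q^(-n|k|)`. Everything else is bounded uniformly on the polydisc and in `k`. -/
theorem exists_norm_regTerm_le {n : ℕ} {q α : ℂ} {x : Fin n → ℂ} (hx : QGeneric q x)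
    (hq : ‖q‖ < 1) (ρ : Fin n → ℝ) (hρ : ∀ s, 0 < ρ s) :
    ∃ C : ℝ, 0 ≤ C ∧ ∀ (a : Fin n → ℂ), (∀ s, ‖a s‖ ≤ ρ s) → ∀ (k : Fin n → ℕ) (I : ℂ),
      ‖regTerm q α x a k I‖ ≤ C * ((∏ s, ρ s) / ‖q‖ ^ n) ^ (∑ t, k t) * ‖I‖ := by
  have hq0 : 0 < ‖q‖ := norm_pos_iff.2 hx.q_ne
  have h1q : 0 < 1 - ‖q‖ := by linarith
  have hδ' : ∀ r s, qPochInf q (q * x r / x s) ≠ 0 := fun r s =>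
    qPochInf_ne_zero hq fun i => hx.one_sub_ne r s i
  choose δ hδ0 hδ using fun r s => exists_le_norm_qPoch hq (hδ' r s)
  let C1 : ℝ := ∏ r, ∏ s ∈ Finset.Ioi r, (‖x r‖ + ‖x s‖) / ‖x r - x s‖
  let C2 : ℝ := ∏ r, ∏ s, Real.exp (‖q * x r / x s‖ / ρ s / (1 - ‖q‖)) / δ r s
  let C3 : ℝ := ∏ r, (1 + ‖α‖ * ‖x r‖) / ‖1 - α * x r‖
  let C4 : ℝ := ∏ r, Real.exp (‖α * x r‖ / (1 - ‖q‖)) * Real.exp (‖α * x r‖ * ρ r / (1 - ‖q‖))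
  have hC1 : 0 ≤ C1 := Finset.prod_nonneg fun r _ => Finset.prod_nonneg fun s _ => by positivity
  have hC2 : 0 ≤ C2 := Finset.prod_nonneg fun r _ => Finset.prod_nonneg fun s _ =>
    div_nonneg (Real.exp_pos _).le (hδ0 r s).le
  have hC3 : 0 ≤ C3 := Finset.prod_nonneg fun r _ => by positivity
  have hC4 : 0 ≤ C4 := Finset.prod_nonneg fun r _ => by positivity
  refine ⟨C1 * C2 * C3 * C4, by positivity, fun a ha k I => ?_⟩
  have hpow : ∀ i : ℕ, ‖q‖ ^ i ≤ 1 := fun i => pow_le_one₀ hq0.le hq.le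
  have b1 : ‖vdmQuot q x k‖ ≤ C1 := by
    rw [vdmQuot, norm_prod]
    refine Finset.prod_le_prod (fun _ _ => norm_nonneg _) fun r _ => ?_
    rw [norm_prod]
    refine Finset.prod_le_prod (fun _ _ => norm_nonneg _) fun s _ => ?_
    rw [norm_div]
    refine div_le_div_of_nonneg_right ((norm_sub_le _ _).trans ?_) (norm_nonneg _)
    simp only [qNode, norm_mul, norm_pow]
    exact add_le_add (mul_le_of_le_one_right (norm_nonneg _) (hpow _))
      (mul_le_of_le_one_right (norm_nonneg _) (hpow _))
  have b2 : ‖∏ r, ∏ s, (∏ i ∈ Finset.range (k r), (a s - q * x r / x s * q ^ i))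
      / qPoch q (q * x r / x s) (k r)‖ ≤ C2 * (∏ s, ρ s) ^ (∑ t, k t) := by
    have e : (∏ s, ρ s) ^ (∑ t, k t) = ∏ r : Fin n, ∏ s, ρ s ^ k r := by
      simp only [Finset.prod_pow, Finset.prod_pow_eq_pow_sum]
    simp only [C2]
    rw [e, ← Finset.prod_mul_distrib, norm_prod]
    refine Finset.prod_le_prod (fun _ _ => norm_nonneg _) fun r _ => ?_
    rw [← Finset.prod_mul_distrib, norm_prod]
    refine Finset.prod_le_prod (fun _ _ => norm_nonneg _) fun s _ => ?_
    rw [norm_div, norm_prod, div_mul_eq_mul_div]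
    refine div_le_div₀ (by have := hρ s; positivity) ?_ (hδ0 r s) (hδ r s _)
    have hb := norm_prod_add_pow_le hq0.le hq le_rfl
      (div_nonneg (norm_nonneg (q * x r / x s)) (hρ s).le) (k r)
    rw [one_pow, one_mul] at hb
    calc _ ≤ ∏ i ∈ Finset.range (k r), ((1 + ‖q * x r / x s‖ / ρ s * ‖q‖ ^ i) * ρ s) := by
          refine Finset.prod_le_prod (fun _ _ => norm_nonneg _) fun i _ => ?_
          refine (norm_sub_le _ _).trans ?_
          have h1 := (hρ s).ne'
          have e2 : (1 + ‖q * x r / x s‖ / ρ s * ‖q‖ ^ i) * ρ s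
              = ρ s + ‖q * x r / x s‖ * ‖q‖ ^ i := by
            field_simp
          rw [e2, norm_mul, norm_pow]
          exact add_le_add (ha s) le_rfl
      _ ≤ _ := by
          rw [Finset.prod_mul_distrib, Finset.prod_const, Finset.card_range]
          exact mul_le_mul_of_nonneg_right hb (pow_nonneg (hρ s).le _)
  have b3 : ‖∏ r, (1 - α * q ^ (∑ t, k t) * qNode q x k r) / (1 - α * x r)‖ ≤ C3 := by
    rw [norm_prod]
    refine Finset.prod_le_prod (fun _ _ => norm_nonneg _) fun r _ => ?_
    rw [norm_div]
    refine div_le_div_of_nonneg_right ((norm_sub_le _ _).trans ?_) (norm_nonneg _)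
    rw [norm_one, qNode, norm_mul, norm_mul, norm_mul, norm_pow, norm_pow]
    refine add_le_add le_rfl (mul_le_mul ?_ ?_ (by positivity) (norm_nonneg _))
    · exact mul_le_of_le_one_right (norm_nonneg _) (hpow _)
    · exact mul_le_of_le_one_right (norm_nonneg _) (hpow _)
  have b4 : ‖∏ r, qPoch q (α * x r) (∑ t, k t) * qPochInf q (α * x r * a r * q ^ (∑ t, k t))‖
      ≤ C4 := by
    rw [norm_prod]
    refine Finset.prod_le_prod (fun _ _ => norm_nonneg _) fun r _ => ?_
    rw [norm_mul]
    refine mul_le_mul (norm_qPoch_le hq _ _) ((norm_qPochInf_le hq _).trans ?_)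
      (norm_nonneg _) (Real.exp_pos _).le
    refine Real.exp_le_exp.2 (div_le_div_of_nonneg_right ?_ h1q.le)
    rw [norm_mul, norm_mul, norm_pow]
    exact (mul_le_of_le_one_right (by positivity) (hpow _)).trans
      (mul_le_mul_of_nonneg_left (ha r) (norm_nonneg _))
  rw [regTerm, norm_mul, norm_mul, norm_mul, norm_mul, norm_mul]
  refine mul_le_mul_of_nonneg_right ?_ (norm_nonneg I)
  rw [norm_inv, norm_pow, norm_pow, div_pow]
  have hρ0 : 0 ≤ ∏ s, ρ s := Finset.prod_nonneg fun s _ => (hρ s).le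
  calc _ ≤ C1 * (C2 * (∏ s, ρ s) ^ (∑ t, k t)) * ((‖q‖ ^ n) ^ (∑ t, k t))⁻¹ * C3 * C4 := by
        gcongr
    _ = _ := by ring

/-! ### Genericity of the parameters and the terminating case. -/

theorem QGeneric.of_qPoch_ne {n : ℕ} {q : ℂ} {x : Fin n → ℂ} (hq0 : 0 < ‖q‖) (hq1 : ‖q‖ < 1)
    (hx : ∀ r, x r ≠ 0) (hxx : ∀ r s, r < s → 1 - x r / x s ≠ 0)
    (hqxx : ∀ r s, ∀ k : ℕ, qPoch q (q * x r / x s) k ≠ 0) : QGeneric q x := by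
  have hq : q ≠ 0 := norm_pos_iff.1 hq0
  have hne : ∀ r s, r ≠ s → x r ≠ x s := by
    intro r s hrs h
    rcases lt_or_gt_of_ne hrs with h' | h'
    · exact hxx r s h' (by rw [h, div_self (hx s), sub_self])
    · exact hxx s r h' (by rw [h, div_self (hx s), sub_self])
  have hlt : ∀ r s, r ≠ s → ∀ i j : ℕ, i ≤ j → x r * q ^ i ≠ x s * q ^ j := by
    intro r s hrs i j hij h
    obtain ⟨d, rfl⟩ := Nat.exists_eq_add_of_le hij
    have h1 : x r = x s * q ^ d := by
      refine mul_right_cancel₀ (pow_ne_zero i hq) ?_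
      rw [h, pow_add]
      ring
    rcases d with _ | d
    · exact hne r s hrs (by simpa using h1)
    · have h2 := hqxx s r (d + 1)
      rw [qPoch_succ] at h2
      refine right_ne_zero_of_mul h2 ?_
      have h3 : q * x s / x r * q ^ d = 1 := by
        rw [div_mul_eq_mul_div, div_eq_one_iff_eq (hx r), h1, pow_succ]
        ring
      rw [h3, sub_self]
  refine ⟨hq, fun k h => ?_, hx, fun r s hrs i j => ?_⟩
  · have h1 : ‖q‖ ^ (k + 1) < 1 := pow_lt_one₀ (norm_nonneg q) hq1 (Nat.succ_ne_zero k)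
    rw [← norm_pow, h, norm_one] at h1
    exact lt_irrefl _ h1
  · rcases le_total i j with h | h
    · exact hlt r s hrs i j h
    · exact (hlt s r hrs.symm j i h).symm

/-- Now `x_s a_s / q = x_s q^(M_s)`, so the weight kills every `k` not below `M` and
`terminating_expansion` applies. On the product side `A = q^|M|`, and the infinite products cancel
to finite ones. -/
theorem hasSum_anOuterTerm_of_pow {n : ℕ} {q α b c d β γ : ℂ} {x a : Fin n → ℂ}
    (hx : QGeneric q x) (hq : ‖q‖ < 1) (M : Fin n → ℕ) (ha : ∀ r, a r = q ^ (M r + 1))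
    (hαx : ∀ r, 1 - α * x r ≠ 0)
    (hαbx : ∀ r, qPochInf q (α * b * x r) ≠ 0)
    (hαax : ∀ r, qPochInf q (α * a r * x r) ≠ 0)
    (hαc : qPochInf q (α * c) ≠ 0) (hαd : qPochInf q (α * d) ≠ 0)
    (hαβ : qPochInf q (α * β * ((∏ r, a r) / q ^ n)) ≠ 0)
    (hαγ : qPochInf q (α * γ * ((∏ r, a r) / q ^ n)) ≠ 0) :
    HasSum (fun k : Fin n → ℕ => anOuterTerm q α b c d β γ x a k)
      (anProductSide q α b c d β γ x a) := by
  have hq0 := hx.q_ne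
  have hw : (fun s => x s * a s / q) = qNode q x M := by
    funext s
    rw [ha, qNode, pow_succ]
    field_simp
  have hA : (∏ r, a r) / q ^ n = q ^ ∑ t, M t := by
    rw [div_eq_iff (pow_ne_zero n hq0)]
    simp only [ha, pow_succ, Finset.prod_mul_distrib, Finset.prod_const, Finset.card_univ,
      Fintype.card_fin, Finset.prod_pow_eq_pow_sum]
  have hαw : ∀ r, α * qNode q x M r * q = α * x r * a r := fun r => by
    rw [ha, qNode, pow_succ]
    ring
  have hαw' : ∀ r, α * a r * x r = α * x r * a r := fun r => by ring
  have hαn : ∀ r j, qPoch q (α * qNode q x M r * q) j ≠ 0 := fun r j => by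
    have := qPoch_ne_zero_of_qPochInf hq (hαax r) j
    rwa [hαw, ← hαw']
  have key := terminating_expansion hx M hαn hαx
    (fun m => innerCoeff q α c d β γ (∑ t, m t) / ∏ r, qPoch q (α * b * x r) (m r))
  have hsum : HasSum (fun k : Fin n → ℕ => anOuterTerm q α b c d β γ x a k)
      (∑ k ∈ Finset.Iic M, anOuterTerm q α b c d β γ x a k) :=
    hasSum_sum_of_ne_finset_zero (fun k hk => by
      rw [anOuterTerm_eq hx, hw, anWeight_qNode_eq_zero hx M k fun h => hk (Finset.mem_Iic.2 h)]
      simp only [zero_mul])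
  convert hsum using 1
  rw [hA] at hαβ hαγ
  set μ := ∑ t, M t with hμ
  calc anProductSide q α b c d β γ x a
      = (∏ r, qPoch q (α * q * x r) (M r))
        * (innerCoeff q α c d β γ μ / ∏ r, qPoch q (α * b * x r) (M r)) := by
        simp only [anProductSide, hA]
        have e1 : ∀ z : ℂ, qPochInf q (α * z) = qPoch q (α * z) μ * qPochInf q (α * z * q ^ μ) :=
          fun z => qPochInf_eq_mul hq _ _
        have e2 : ∀ r, qPochInf q (α * q * x r) * qPochInf q (α * a r * b * x r / q)
            / (qPochInf q (α * b * x r) * qPochInf q (α * a r * x r))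
            = qPoch q (α * q * x r) (M r) / qPoch q (α * b * x r) (M r) := by
          intro r
          have h1 : α * q * x r * q ^ M r = α * a r * x r := by
            rw [ha, pow_succ]
            ring
          have h2 : α * a r * b * x r / q = α * b * x r * q ^ M r := by
            rw [ha, pow_succ]
            field_simp
          have h3 := hαbx r
          rw [qPochInf_eq_mul hq (α * b * x r) (M r)] at h3 ⊢
          rw [qPochInf_eq_mul hq (α * q * x r) (M r), h1, h2]
          have h4 := left_ne_zero_of_mul h3
          have h5 := right_ne_zero_of_mul h3
          have h6 := hαax r
          rw [div_eq_div_iff (mul_ne_zero h3 h6) h4]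
          ring
        have hc' := hαc
        have hd' := hαd
        rw [e1] at hc' hd'
        simp only [e2, Finset.prod_div_distrib]
        rw [e1 β, e1 γ, e1 c, e1 d, innerCoeff, show α * q ^ μ * c = α * c * q ^ μ by ring,
          show α * q ^ μ * d = α * d * q ^ μ by ring]
        have h1 := left_ne_zero_of_mul hc'
        have h2 := right_ne_zero_of_mul hc'
        have h3 := left_ne_zero_of_mul hd'
        have h4 := right_ne_zero_of_mul hd'
        have h5 : ∀ P Q Bm Gm Cm Dm Bi Gi Ci Di : ℂ, Bi ≠ 0 → Gi ≠ 0 → Ci ≠ 0 → Di ≠ 0 →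
            Cm ≠ 0 → Dm ≠ 0 →
            Bm * Bi * (Gm * Gi) * Ci * Di / (Cm * Ci * (Dm * Di) * Bi * Gi) * (P / Q)
              = P * (Bm / Cm * (Gm / Dm) / Q) := by
          intro P Q Bm Gm Cm Dm Bi Gi Ci Di _ _ _ _ _ _
          have : Bm * Bi * (Gm * Gi) * Ci * Di / (Cm * Ci * (Dm * Di) * Bi * Gi)
              = Bm / Cm * (Gm / Dm) := by
            field_simp
          rw [this]
          ring
        exact h5 _ _ _ _ _ _ _ _ _ _ hαβ hαγ h2 h4 h1 h3
    _ = _ := by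
        rw [← key]
        refine Finset.sum_congr rfl fun k _ => ?_
        rw [anOuterTerm_eq hx, hw, hA, anInnerSum_eq hx]
        simp only [hαw]
        congr 1
        refine Finset.sum_congr rfl fun m _ => ?_
        rw [Finset.prod_div_distrib]
        ring

/-! ### Analytic continuation in the `a_r`. -/

/-- The product side multiplied by `∏ (α a_r x_r)_∞`. -/
noncomputable def regProduct {n : ℕ} (q α b c d β γ : ℂ) (x a : Fin n → ℂ) : ℂ :=
  qPochInf q (α * β) * qPochInf q (α * γ) * qPochInf q (α * ((∏ r, a r) / q ^ n) * c)
      * qPochInf q (α * ((∏ r, a r) / q ^ n) * d)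
      / (qPochInf q (α * c) * qPochInf q (α * d)
        * qPochInf q (α * β * ((∏ r, a r) / q ^ n)) * qPochInf q (α * γ * ((∏ r, a r) / q ^ n)))
    * ∏ r, qPochInf q (α * q * x r) * qPochInf q (α * a r * b * x r / q)
        / qPochInf q (α * b * x r)

theorem anProductSide_mul_eq_regProduct {n : ℕ} {q α b c d β γ : ℂ} {x a : Fin n → ℂ}
    (hαax : ∀ r, qPochInf q (α * x r * a r) ≠ 0) :
    anProductSide q α b c d β γ x a * ∏ r, qPochInf q (α * x r * a r)
      = regProduct q α b c d β γ x a := by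
  simp only [anProductSide, regProduct]
  rw [mul_assoc, ← Finset.prod_mul_distrib]
  congr 1
  refine Finset.prod_congr rfl fun r _ => ?_
  have h1 := hαax r
  rw [mul_right_comm α (a r) (x r), ← div_div, div_mul_cancel₀ _ h1]

theorem qPochInf_ne_zero_of_norm_lt_one {q z : ℂ} (hq : ‖q‖ < 1) (hz : ‖z‖ < 1) :
    qPochInf q z ≠ 0 := by
  refine qPochInf_ne_zero hq fun i h => ?_
  have h1 : ‖z * q ^ i‖ < 1 := by
    rw [norm_mul, norm_pow]
    exact mul_lt_one_of_nonneg_of_lt_one_left (norm_nonneg z) hz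
      (pow_le_one₀ (norm_nonneg q) hq.le)
  rw [← sub_eq_zero.1 h, norm_one] at h1
  exact lt_irrefl _ h1

theorem differentiableOn_regProduct_update {n : ℕ} {q : ℂ} (hq : ‖q‖ < 1)
    (α b c d β γ : ℂ) (x a : Fin n → ℂ) (j : Fin n) (U : Set ℂ)
    (hαc : qPochInf q (α * c) ≠ 0) (hαd : qPochInf q (α * d) ≠ 0)
    (hU : ∀ τ ∈ U, ‖α * β * ((∏ r, Function.update a j τ r) / q ^ n)‖ < 1
      ∧ ‖α * γ * ((∏ r, Function.update a j τ r) / q ^ n)‖ < 1) :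
    DifferentiableOn ℂ (fun τ => regProduct q α b c d β γ x (Function.update a j τ)) U := by
  have hu : ∀ r, Differentiable ℂ fun τ : ℂ => Function.update a j τ r := by
    intro r
    by_cases hr : r = j
    · subst hr
      simp only [Function.update_self]
      exact differentiable_id
    · simp only [Function.update_of_ne hr]
      exact differentiable_const _
  have hA : Differentiable ℂ fun τ : ℂ => (∏ r, Function.update a j τ r) / q ^ n :=
    (Differentiable.fun_finsetProd fun r _ => hu r).div_const _
  have hd := differentiable_qPochInf hq
  have hA1 : ∀ u v : ℂ, Differentiable ℂ fun τ : ℂ =>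
      qPochInf q (u * ((∏ r, Function.update a j τ r) / q ^ n) * v) := fun u v =>
    hd.comp ((hA.const_mul u).mul_const v)
  have hA2 : ∀ u : ℂ, Differentiable ℂ fun τ : ℂ =>
      qPochInf q (u * ((∏ r, Function.update a j τ r) / q ^ n)) := fun u =>
    hd.comp (hA.const_mul u)
  unfold regProduct
  refine DifferentiableOn.mul (DifferentiableOn.div ?_ ?_ fun τ hτ => ?_) ?_
  · exact (((hA1 _ _).const_mul _).mul (hA1 _ _)).differentiableOn
  · exact (((hA2 _).const_mul _).mul (hA2 _)).differentiableOn
  · exact mul_ne_zero (mul_ne_zero (mul_ne_zero hαc hαd)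
      (qPochInf_ne_zero_of_norm_lt_one hq (hU τ hτ).1))
      (qPochInf_ne_zero_of_norm_lt_one hq (hU τ hτ).2)
  · refine Differentiable.differentiableOn (Differentiable.fun_finsetProd fun r _ => ?_)
    refine Differentiable.div_const (Differentiable.const_mul ?_ _) _
    exact hd.comp (((((hu r).const_mul α).mul_const b).mul_const (x r)).div_const q)

/-- Each of the two quotients has `q`-differences of rate `R`, and so has their product up to `1 +
ε`. The rate involves the maximum of `‖αβ‖` and `‖αγ‖`, not their product. -/
theorem exists_norm_anInnerSum_le {n : ℕ} {q α b c d β γ : ℂ} {x : Fin n → ℂ}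
    (hx : QGeneric q x) (hq : ‖q‖ < 1) (hαbx : ∀ r, qPochInf q (α * b * x r) ≠ 0)
    (hαc : qPochInf q (α * c) ≠ 0) (hαd : qPochInf q (α * d) ≠ 0) {R ε : ℝ} (hR : 1 ≤ R)
    (hβ : ‖α * β‖ ≤ R) (hγ : ‖α * γ‖ ≤ R) (hε : 0 < ε) (hε1 : ε ≤ 1) :
    ∃ C : ℝ, 0 ≤ C ∧ ∀ k : Fin n → ℕ,
      ‖anInnerSum q α b c d β γ x k‖ ≤ C * ((1 + ε) * R) ^ (∑ t, k t) := by
  obtain ⟨B, _, hB⟩ := exists_qDiffBound_qPoch_div hx.q_ne hq hαc hR hβ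
  obtain ⟨B', _, hB'⟩ := exists_qDiffBound_qPoch_div hx.q_ne hq hαd hR hγ
  obtain ⟨B'', hB''⟩ := hB.exists_mul hx.q_ne hq (zero_le_one.trans hR) hε hε1 hB'
  simp only [anInnerSum_eq_dualSum hx]
  exact exists_norm_dualSum_le hx hq hαbx (by nlinarith) _ hB''

/-- Induction on the set `S` of freed variables; the remaining ones are powers `q^(N+1)`. The bound
`N ≥ N₀` keeps `(α x_r a_r)_∞` nonzero in the base case, so that the terminating identity can be
used there. -/
theorem hasSum_regTerm {n : ℕ} {q α b c d β γ : ℂ} {x : Fin n → ℂ}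
    (hx : QGeneric q x) (hq : ‖q‖ < 1) (hαx : ∀ r, 1 - α * x r ≠ 0)
    (hαbx : ∀ r, qPochInf q (α * b * x r) ≠ 0)
    (hαc : qPochInf q (α * c) ≠ 0) (hαd : qPochInf q (α * d) ≠ 0) {R : ℝ} (hR : 1 ≤ R)
    (hβ : ‖α * β‖ ≤ R) (hγ : ‖α * γ‖ ≤ R) {C : ℝ}
    (hC : ∀ k : Fin n → ℕ, ‖anInnerSum q α b c d β γ x k‖ ≤ C * R ^ (∑ t, k t))
    {N₀ : ℕ} (hN₀ : ∀ r, ‖α * x r‖ * ‖q‖ ^ N₀ < 1) (S : Finset (Fin n)) :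
    ∀ a : Fin n → ℂ, (∀ r, a r ≠ 0) → (∀ r ∉ S, ∃ N : ℕ, N₀ ≤ N ∧ a r = q ^ (N + 1)) →
      R * ‖(∏ r, a r) / q ^ n‖ < 1 →
      HasSum (fun k => regTerm q α x a k (anInnerSum q α b c d β γ x k))
        (regProduct q α b c d β γ x a) := by
  have hq0 : 0 < ‖q‖ := norm_pos_iff.2 hx.q_ne
  have hlt : ∀ u z : ℂ, ‖u‖ ≤ R → R * ‖z‖ < 1 → ‖u * z‖ < 1 := fun u z hu hz => by
    rw [norm_mul]
    exact (mul_le_mul_of_nonneg_right hu (norm_nonneg z)).trans_lt hz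
  induction S using Finset.induction_on with
  | empty =>
    intro a ha0 ha hA
    choose M hM0 hM using fun r => ha r (Finset.notMem_empty r)
    have hαax : ∀ r, qPochInf q (α * x r * a r) ≠ 0 := fun r => by
      refine qPochInf_ne_zero_of_norm_lt_one hq ?_
      rw [norm_mul, hM r, norm_pow]
      refine lt_of_le_of_lt (mul_le_mul_of_nonneg_left ?_ (norm_nonneg _)) (hN₀ r)
      exact pow_le_pow_of_le_one hq0.le hq.le ((hM0 r).trans (Nat.le_succ _))
    have hαax' : ∀ r, qPochInf q (α * a r * x r) ≠ 0 := fun r => by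
      rw [mul_right_comm]
      exact hαax r
    have h := hasSum_anOuterTerm_of_pow hx hq M hM hαx hαbx hαax' hαc hαd
      (qPochInf_ne_zero_of_norm_lt_one hq (hlt (α * β) _ hβ hA))
      (qPochInf_ne_zero_of_norm_lt_one hq (hlt (α * γ) _ hγ hA))
    have h2 := h.mul_right (∏ r, qPochInf q (α * x r * a r))
    rw [anProductSide_mul_eq_regProduct hαax] at h2
    refine h2.congr_fun ?_
    intro k
    exact (anOuterTerm_mul_eq_regTerm hx hq α b c d β γ a ha0 hαax k).symm
  | insert j S hj ih =>
    intro a ha0 ha hA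
    -- `Q` is chosen so that the convergence condition, as a function of the `j`-th variable `τ`
    -- alone, reads `Q * ‖τ‖ < 1`.
    set Q : ℝ := R * (∏ r, if r = j then 1 else ‖a r‖) / ‖q‖ ^ n with hQ
    have hQ0 : 0 < Q := by
      have : 0 < ∏ r, if r = j then 1 else ‖a r‖ := Finset.prod_pos fun r _ => by
        split_ifs
        · exact one_pos
        · exact norm_pos_iff.2 (ha0 r)
      positivity
    have hprod : ∀ τ : ℂ, R * ‖(∏ r, Function.update a j τ r) / q ^ n‖ = Q * ‖τ‖ := by
      intro τ
      rw [norm_div, norm_prod, norm_pow, hQ]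
      have : ∏ r, ‖Function.update a j τ r‖ = ‖τ‖ * ∏ r, if r = j then 1 else ‖a r‖ := by
        rw [← Finset.mul_prod_erase Finset.univ _ (Finset.mem_univ j),
          ← Finset.mul_prod_erase Finset.univ (fun r => if r = j then 1 else ‖a r‖)
            (Finset.mem_univ j)]
        simp only [Function.update_self, if_true, one_mul]
        congr 1
        refine Finset.prod_congr rfl fun r hr => ?_
        rw [Function.update_of_ne (Finset.mem_erase.1 hr).1, if_neg (Finset.mem_erase.1 hr).1]
      rw [this]
      ring
    have haj : Q * ‖a j‖ < 1 := by
      rw [← hprod, Function.update_eq_self]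
      exact hA
    -- The disc of radius `ρ` contains both `a j` and the centre `0` where the known points
    -- accumulate, and `Q * ρ < 1` keeps the series uniformly dominated on it.
    obtain ⟨ρ, hρ1, hρ2⟩ := exists_between ((lt_div_iff₀' hQ0).2 haj)
    have hρQ : Q * ρ < 1 := (lt_div_iff₀' hQ0).1 hρ2
    have hρ0 : 0 < ρ := (norm_nonneg _).trans_lt hρ1
    let ρs : Fin n → ℝ := fun r => if r = j then ρ else ‖a r‖
    have hρs : ∀ r, 0 < ρs r := fun r => by
      simp only [ρs]
      split_ifs
      · exact hρ0
      · exact norm_pos_iff.2 (ha0 r)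
    obtain ⟨D, hD0, hD⟩ := exists_norm_regTerm_le (α := α) hx hq ρs hρs
    have hprodρ : R * ((∏ s, ρs s) / ‖q‖ ^ n) = Q * ρ := by
      have : ∏ r, ρs r = ρ * ∏ r, if r = j then 1 else ‖a r‖ := by
        rw [← Finset.mul_prod_erase Finset.univ _ (Finset.mem_univ j),
          ← Finset.mul_prod_erase Finset.univ (fun r => if r = j then 1 else ‖a r‖)
            (Finset.mem_univ j)]
        simp only [ρs, if_true, one_mul]
        congr 1
        refine Finset.prod_congr rfl fun r hr => ?_
        rw [if_neg (Finset.mem_erase.1 hr).1, if_neg (Finset.mem_erase.1 hr).1]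
      rw [this, hQ]
      ring
    set U := Metric.ball (0 : ℂ) ρ with hU
    have hbound : ∀ (k : Fin n → ℕ) (τ : ℂ), τ ∈ U →
        ‖regTerm q α x (Function.update a j τ) k (anInnerSum q α b c d β γ x k)‖
          ≤ D * C * (Q * ρ) ^ (∑ t, k t) := by
      intro k τ hτ
      rw [hU, mem_ball_zero_iff] at hτ
      refine (hD _ (fun s => ?_) k _).trans ?_
      · by_cases hs : s = j
        · subst hs
          simp only [ρs, Function.update_self, if_true]
          exact hτ.le
        · simp only [ρs, Function.update_of_ne hs, if_neg hs, le_refl]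
      · have h0 : 0 ≤ (∏ s, ρs s) / ‖q‖ ^ n :=
          div_nonneg (Finset.prod_nonneg fun s _ => (hρs s).le) (by positivity)
        calc _ ≤ D * ((∏ s, ρs s) / ‖q‖ ^ n) ^ (∑ t, k t) * (C * R ^ (∑ t, k t)) :=
              mul_le_mul_of_nonneg_left (hC k) (by positivity)
          _ = _ := by
            rw [← hprodρ, mul_pow]
            ring
    have hsummable : Summable fun k : Fin n → ℕ => D * C * (Q * ρ) ^ (∑ t, k t) :=
      (summable_pow_sum n (by positivity) hρQ).mul_left _
    have hdiff1 := Complex.differentiableOn_tsum_of_summable_norm hsummable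
      (fun k => (differentiable_regTerm_update hq α x a j k
        (anInnerSum q α b c d β γ x k)).differentiableOn) Metric.isOpen_ball hbound
    have hUlt : ∀ τ ∈ U, R * ‖(∏ r, Function.update a j τ r) / q ^ n‖ < 1 := fun τ hτ => by
      rw [hU, mem_ball_zero_iff] at hτ
      rw [hprod]
      exact (mul_lt_mul_of_pos_left hτ hQ0).trans hρQ
    have hdiff2 := differentiableOn_regProduct_update hq α b c d β γ x a j U hαc hαd
      fun τ hτ => ⟨hlt _ _ hβ (hUlt τ hτ), hlt _ _ hγ (hUlt τ hτ)⟩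
    have h0U : (0 : ℂ) ∈ U := Metric.mem_ball_self hρ0
    have hev : ∀ᶠ N : ℕ in Filter.atTop,
        ∑' k, regTerm q α x (Function.update a j (q ^ (N + 1))) k
          (anInnerSum q α b c d β γ x k)
        = regProduct q α b c d β γ x (Function.update a j (q ^ (N + 1))) := by
      have h1 : Filter.Tendsto (fun N : ℕ => q ^ (N + 1)) Filter.atTop (nhds 0) :=
        (tendsto_pow_atTop_nhds_zero_of_norm_lt_one hq).comp (Filter.tendsto_add_atTop_nat 1)
      filter_upwards [h1.eventually (Metric.isOpen_ball.mem_nhds h0U),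
        Filter.eventually_ge_atTop N₀] with N hN hN'
      refine (ih _ (fun r => ?_) (fun r hr => ?_) (hUlt _ hN)).tsum_eq
      · by_cases hrj : r = j
        · subst hrj
          rw [Function.update_self]
          exact pow_ne_zero _ hx.q_ne
        · rw [Function.update_of_ne hrj]
          exact ha0 r
      · by_cases hrj : r = j
        · subst hrj
          exact ⟨N, hN', Function.update_self ..⟩
        · rw [Function.update_of_ne hrj]
          exact ha r fun h => hr ((Finset.mem_insert.1 h).resolve_left hrj)
    -- The identity theorem needs agreement at points other than the centre; the powers `q^(N+1)`
    -- are nonzero.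
    have hfreq : ∃ᶠ τ in nhdsWithin (0 : ℂ) {0}ᶜ,
        ∑' k, regTerm q α x (Function.update a j τ) k (anInnerSum q α b c d β γ x k)
          = regProduct q α b c d β γ x (Function.update a j τ) := by
      have h1 : Filter.Tendsto (fun N : ℕ => q ^ (N + 1)) Filter.atTop
          (nhdsWithin (0 : ℂ) {0}ᶜ) :=
        tendsto_nhdsWithin_iff.2 ⟨(tendsto_pow_atTop_nhds_zero_of_norm_lt_one hq).comp
          (Filter.tendsto_add_atTop_nat 1),
          Filter.Eventually.of_forall fun N => pow_ne_zero _ hx.q_ne⟩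
      exact h1.frequently hev.frequently
    have heq := (hdiff1.analyticOnNhd Metric.isOpen_ball).eqOn_of_preconnected_of_frequently_eq
      (hdiff2.analyticOnNhd Metric.isOpen_ball) (convex_ball (0 : ℂ) ρ).isPreconnected h0U hfreq
    have hajU : a j ∈ U := mem_ball_zero_iff.2 hρ1
    have hfin := heq hajU
    have hsum := (Summable.of_norm_bounded hsummable fun k => hbound k (a j) hajU).hasSum
    simp only [Function.update_eq_self] at hfin hsum
    rwa [hfin] at hsum

/-! ### Assembly of the theorem. -/

theorem mainTheorem5 (n : ℕ) (q α b c d β γ : ℂ) (x a : Fin n → ℂ)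
    (hq0 : 0 < ‖q‖) (hq1 : ‖q‖ < 1)
    -- convergence, or termination
    (hconv :
      (‖(∏ r, a r) / q ^ n‖ < 1 ∧ ‖α * β * ((∏ r, a r) / q ^ n)‖ < 1 ∧
        ‖α * γ * ((∏ r, a r) / q ^ n)‖ < 1) ∨
      (∃ N : Fin n → ℕ, (∀ r, 1 ≤ N r) ∧ ∀ r, a r = q ^ N r))
    -- none of the denominators vanishes
    (hx : ∀ r, x r ≠ 0) (ha : ∀ r, a r ≠ 0)
    (hxx : ∀ r s, r < s → 1 - x r / x s ≠ 0)
    (hqxx : ∀ r s, ∀ k : ℕ, qPoch q (q * x r / x s) k ≠ 0)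
    (hαx : ∀ r, 1 - α * x r ≠ 0)
    (hαbx : ∀ r, qPochInf q (α * b * x r) ≠ 0)
    (hαax : ∀ r, qPochInf q (α * a r * x r) ≠ 0)
    (hαc : qPochInf q (α * c) ≠ 0) (hαd : qPochInf q (α * d) ≠ 0)
    (hαβ : qPochInf q (α * β * ((∏ r, a r) / q ^ n)) ≠ 0)
    (hαγ : qPochInf q (α * γ * ((∏ r, a r) / q ^ n)) ≠ 0) :
    HasSum (fun k : Fin n → ℕ => anOuterTerm q α b c d β γ x a k)
      (anProductSide q α b c d β γ x a) := by
  have hgen : QGeneric q x := QGeneric.of_qPoch_ne hq0 hq1 hx hxx hqxx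
  rcases hconv with ⟨hA, hβA, hγA⟩ | ⟨N, hN1, hN⟩
  · set A := (∏ r, a r) / q ^ n with hAdef
    have hA0 : 0 < ‖A‖ := norm_pos_iff.2
      (div_ne_zero (Finset.prod_ne_zero_iff.2 fun r _ => ha r) (pow_ne_zero n hgen.q_ne))
    -- The three convergence conditions together say exactly that `R₀ * ‖A‖ < 1`.
    set R₀ : ℝ := max 1 (max ‖α * β‖ ‖α * γ‖) with hR₀
    have hR₀1 : 1 ≤ R₀ := le_max_left _ _
    have hR₀β : ‖α * β‖ ≤ R₀ := (le_max_left _ _).trans (le_max_right _ _)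
    have hR₀γ : ‖α * γ‖ ≤ R₀ := (le_max_right _ _).trans (le_max_right _ _)
    have hR₀A : R₀ * ‖A‖ < 1 := by
      rw [norm_mul] at hβA hγA
      rw [hR₀, max_mul_of_nonneg _ _ hA0.le, max_mul_of_nonneg _ _ hA0.le, one_mul]
      exact max_lt hA (max_lt hβA hγA)
    have hR₀pos : 0 < R₀ * ‖A‖ := by positivity
    obtain ⟨ε, hε, hε1, hεA⟩ : ∃ ε : ℝ, 0 < ε ∧ ε ≤ 1 ∧ (1 + ε) * R₀ * ‖A‖ < 1 := by
      -- With `t = R₀ * ‖A‖`, the required inequality `(1 + (1 - t)/2) t < 1` amounts to `(1 - t)(2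
      -- - t) > 0`.
      refine ⟨(1 - R₀ * ‖A‖) / 2, by linarith, by linarith, ?_⟩
      nlinarith
    obtain ⟨C, -, hC⟩ := exists_norm_anInnerSum_le (b := b) hgen hq1 hαbx hαc hαd hR₀1
      hR₀β hR₀γ hε hε1
    have hR₀R : R₀ ≤ (1 + ε) * R₀ := by nlinarith
    obtain ⟨N₀, hN₀⟩ : ∃ N₀ : ℕ, ∀ r, ‖α * x r‖ * ‖q‖ ^ N₀ < 1 := by
      have h : ∀ r, ∀ᶠ N : ℕ in Filter.atTop, ‖α * x r‖ * ‖q‖ ^ N < 1 := fun r => by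
        have h1 := (tendsto_pow_atTop_nhds_zero_of_lt_one (norm_nonneg q) hq1).const_mul
          ‖α * x r‖
        rw [mul_zero] at h1
        exact h1.eventually (gt_mem_nhds one_pos)
      exact (Filter.eventually_all.2 h).exists
    have hαax' : ∀ r, qPochInf q (α * x r * a r) ≠ 0 := fun r => by
      rw [mul_right_comm]
      exact hαax r
    have h := hasSum_regTerm hgen hq1 hαx hαbx hαc hαd (hR₀1.trans hR₀R) (hR₀β.trans hR₀R)
      (hR₀γ.trans hR₀R) hC hN₀ Finset.univ a ha
      (fun r hr => absurd (Finset.mem_univ r) hr) hεA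
    have hP : ∏ r, qPochInf q (α * x r * a r) ≠ 0 :=
      Finset.prod_ne_zero_iff.2 fun r _ => hαax' r
    simp only [← anOuterTerm_mul_eq_regTerm hgen hq1 α b c d β γ a ha hαax'] at h
    rw [← anProductSide_mul_eq_regProduct hαax'] at h
    exact (hasSum_mul_right_iff hP).1 h
  -- The terminating case is stated for `a_r = q^(M_r + 1)`, so positivity of the exponents is what
  -- allows `M_r = N_r - 1`.
  · refine hasSum_anOuterTerm_of_pow hgen hq1 (fun r => N r - 1) (fun r => ?_) hαx hαbx hαax
      hαc hαd hαβ hαγ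
    rw [hN r, Nat.sub_add_cancel (hN1 r)]
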